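/- **Conventions.** For finitely many spaces $Z_i$ $(i\in I)$, the join $*_{i\in I}Z_i$ is the set of formal convex combinations $\sum_i t_i z_i$ ($t_i\ge 0$, $\sum_i t_i=1$, with $z_i\in Z_i$ recorded only when $t_i>0$), with the coarsest topology making all $t_i$ and all partial maps $z_i$ (defined where $t_i>0$) continuous; for compact Hausdorff spaces this is the usual quotient topology. Empty factors are allowed, so $\emptyset * Z = Z$, and $X^{*n}$ denotes the $n$-fold join of $X$, with $X^{*0}=\emptyset$. For a finite poset $P$, a $P$-diagram $\mathcal D$ consists of spaces $D(p)$ $(p \in P)$ and compatible maps $d_{pq}:D(p)\to D(q)$ for $p\ge q$; its homotopy colimit is $$\operatorname{hocolim}_P\mathcal D=\coprod_{p\in P}\Delta(P_{\le p})\times D(p)\,/\sim,$$ where $\Delta$ is the geometric realization of the order complex and $\sim$ is generated by $(a,x)\sim(a,d_{pq}(x))$ for $p\ge q$, $a\in\Delta(P_{\le q})$, $x\in D(p)$. Let $M$ be a matroid on a finite ground set with rank function $r$, rank $r(M)$ and lattice of flats $L(M)$ (least element $\hat 0$), and let $X$ be a CW complex. For $\rho\in\mathbb N$ with $\rho\ge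 r(M)$, let $B_\rho$ be the lattice of subsets of $[\rho]=\{1,\dots,\rho\}$. A *$\rho$-immersion* of $M$ is an order-reversing map $l:L(M)\to B_\rho$ with $|l(p)|=\rho-r(p)$ for every flat $p$. For $\sigma\in B_\rho$ let $D_X(\sigma)$ be the join over $i=1,\dots,\rho$ of the spaces $X$ (if $i\in\sigma$) and $\emptyset$ (if $i\notin\sigma$), with the inclusions $D_X(\sigma)\subseteq D_X(\tau)$ for $\sigma\subseteq\tau$, and let $\mathcal D_X(M,l)=D_X\circ l$, an $L(M)$-diagram. Put $$\mathcal T_X(M,l)=\bigcup_{a\text{ an atom of }L(M)}\operatorname{hocolim}\,\mathcal D_X(M,l)_{\ge a}\ \subseteq\ \operatorname{hocolim}\,\mathcal D_X(M,l),$$ where $\mathcal D_X(M,l)_{\ge a}$ is the restriction to the flats $p\ge a$. The standard representation is $\mathcal T_X(M)=\mathcal T_X(M,\hat l)$, where $\hat l:L(M)\to B_{r(M)}$ is $\hat l(p)=[r(M)-r(p)]$. **Proposition.** Assume $r(M)\ge 1$ or $\rho=r(M)$. For every $\rho$-immersion $l$ of $M$ there is a homotopy equivalence $$\mathcal T_X(M,l)\;\simeq\;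 X^{*(\rho-r(M))} * \mathcal T_X(M),$$ that is, $\mathcal T_X(M,l)$ is homotopy equivalent to the $(\rho-r(M))$-fold $X$-suspension $X^{*(\rho-r(M))} * (-)$ of the standard representation. -/

import Mathlib

noncomputable section

namespace MatroidTop

open CategoryTheory

universe u v w

/-! ### Joins of spaces -/

/-- The join of a finite family of spaces `Z i`: formal convex combinations `∑ tᵢ zᵢ`, where
`zᵢ ∈ Z i` is recorded only for those `i` with `tᵢ > 0`.  Some, or all, of the `Z i` may be
empty; an empty factor does not contribute. -/
structure Join {ι : Type v} [Fintype ι] (Z : ι → Type u) where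
  weight : ι → ℝ
  weight_mem : weight ∈ stdSimplex ℝ ι
  point : ∀ i, 0 < weight i → Z i

/-- The topology of the join: the coarsest one for which every weight function `tᵢ` is continuous
and every partial function `zᵢ`, defined on the open set `{tᵢ > 0}`, is continuous. -/
instance Join.instTopologicalSpace {ι : Type v} [Fintype ι] (Z : ι → Type u)
    [∀ i, TopologicalSpace (Z i)] : TopologicalSpace (Join Z) :=
  TopologicalSpace.generateFrom
    ({s | ∃ (i : ι) (U : Set ℝ), IsOpen U ∧ s = {z | z.weight i ∈ U}} ∪
     {s | ∃ (i : ι) (V : Set (Z i)), IsOpen V ∧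
        s = {z | ∃ h : 0 < z.weight i, z.point i h ∈ V}})

/-- The map of joins induced by maps of the factors: `∑ tᵢ zᵢ ↦ ∑ tᵢ f(zᵢ)`. -/
def Join.map {ι : Type v} [Fintype ι] {Z : ι → Type u} {W : ι → Type w}
    (f : ∀ i, Z i → W i) (z : Join Z) : Join W where
  weight := z.weight
  weight_mem := z.weight_mem
  point i h := f i (z.point i h)

theorem Join.continuous_map {ι : Type v} [Fintype ι] {Z : ι → Type u} {W : ι → Type w}
    [∀ i, TopologicalSpace (Z i)] [∀ i, TopologicalSpace (W i)]
    {f : ∀ i, Z i → W i} (hf : ∀ i, Continuous (f i)) :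
    Continuous (Join.map f) := by
  refine continuous_generateFrom_iff.2 ?_
  rintro s (⟨i, U, hU, rfl⟩ | ⟨i, V, hV, rfl⟩)
  · exact TopologicalSpace.isOpen_generateFrom_of_mem (Or.inl ⟨i, U, hU, rfl⟩)
  · exact TopologicalSpace.isOpen_generateFrom_of_mem
      (Or.inr ⟨i, f i ⁻¹' V, hV.preimage (hf i), rfl⟩)

/-- The `n`-fold join `X^{*n}`; in particular `X^{*0} = ∅`. -/
abbrev JoinPower (X : Type u) (n : ℕ) : Type u := Join (fun _ : Fin n => X)

/-- The two-member family `A, B`. -/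
def pairFamily (A : Type u) (B : Type v) : Bool → Type (max u v)
  | false => ULift.{v} A
  | true => ULift.{u} B

instance pairFamily.instTopologicalSpace (A : Type u) (B : Type v) [TopologicalSpace A]
    [TopologicalSpace B] : ∀ b, TopologicalSpace (pairFamily A B b)
  | false => inferInstanceAs (TopologicalSpace (ULift.{v} A))
  | true => inferInstanceAs (TopologicalSpace (ULift.{u} B))

/-- The join `A * B` of two spaces. -/
abbrev BinaryJoin (A : Type u) (B : Type v) : Type (max u v) := Join (pairFamily A B)

/-! ### Diagrams of spaces over a finite poset and their homotopy colimits -/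

/-- For an element `p` of a finite poset `P`, the geometric realization `Δ(P_{≤ p})` of the order
complex of `{q | q ≤ p}`, in barycentric coordinates: convex combinations of elements of `P` whose
support is a chain consisting of elements `≤ p`. -/
def OrderComplexBelow (P : Type v) [PartialOrder P] [Fintype P] (p : P) : Type v :=
  {b : P → ℝ // b ∈ stdSimplex ℝ P ∧ IsChain (· ≤ ·) {q | b q ≠ 0} ∧ ∀ q, b q ≠ 0 → q ≤ p}

instance OrderComplexBelow.instTopologicalSpace (P : Type v) [PartialOrder P] [Fintype P] (p : P) :
    TopologicalSpace (OrderComplexBelow P p) :=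
  instTopologicalSpaceSubtype

/-- The inclusion `Δ(P_{≤ q}) ⊆ Δ(P_{≤ p})` for `q ≤ p`. -/
def OrderComplexBelow.incl {P : Type v} [PartialOrder P] [Fintype P] {p q : P} (h : q ≤ p)
    (b : OrderComplexBelow P q) : OrderComplexBelow P p :=
  ⟨b.1, b.2.1, b.2.2.1, fun s hs => (b.2.2.2 s hs).trans h⟩

/-- The disjoint union `∐_p Δ(P_{≤ p}) × D(p)` for a `P`-diagram of spaces `D`.  A `P`-diagram has
a map `D(p) → D(q)` whenever `p ≥ q`, so it is a functor on `Pᵒᵖ` in Mathlib's convention, in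
which there is a morphism `q ⟶ p` of `P` when `q ≤ p`. -/
abbrev PreHocolim {P : Type v} [PartialOrder P] [Fintype P] (D : Pᵒᵖ ⥤ TopCat.{u}) :
    Type (max u v) :=
  Σ p : P, OrderComplexBelow P p × D.obj (Opposite.op p)

/-- The gluing relation: `(a, x) ∼ (a, d_{pq}(x))` for `p ≥ q`, `x ∈ D(p)`, `a ∈ Δ(P_{≤ q})`. -/
inductive HocolimRel {P : Type v} [PartialOrder P] [Fintype P] (D : Pᵒᵖ ⥤ TopCat.{u}) :
    PreHocolim D → PreHocolim D → Prop
  | glue {p q : P} (h : q ≤ p) (a : OrderComplexBelow P q) (x : D.obj (Opposite.op p)) :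
      HocolimRel D ⟨p, a.incl h, x⟩ ⟨q, a, D.map (homOfLE h).op x⟩

/-- The homotopy colimit of a `P`-diagram of spaces, with the quotient topology. -/
def Hocolim {P : Type v} [PartialOrder P] [Fintype P] (D : Pᵒᵖ ⥤ TopCat.{u}) : Type (max u v) :=
  Quot (HocolimRel D)

instance Hocolim.instTopologicalSpace {P : Type v} [PartialOrder P] [Fintype P]
    (D : Pᵒᵖ ⥤ TopCat.{u}) : TopologicalSpace (Hocolim D) :=
  inferInstanceAs (TopologicalSpace (Quot (HocolimRel D)))

/-- The homotopy colimit of the restriction of `D` to `P_{≥ a}`, as a subspace of the homotopy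
colimit of `D`: the classes of all `(b, x)` with `b` supported in `P_{≥ a}`. -/
def hocolimAbove {P : Type v} [PartialOrder P] [Fintype P] (D : Pᵒᵖ ⥤ TopCat.{u}) (a : P) :
    Set (Hocolim D) :=
  {y | ∃ (p : P) (b : OrderComplexBelow P p) (x : D.obj (Opposite.op p)),
    (∀ q, b.1 q ≠ 0 → a ≤ q) ∧ y = Quot.mk (HocolimRel D) ⟨p, b, x⟩}

/-! ### The lattice of flats of a matroid -/

/-- The poset (lattice) of flats of a matroid, ordered by inclusion. -/
def Flats {α : Type v} (M : Matroid α) : Type v := {F : Set α // M.IsFlat F}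

instance {α : Type v} (M : Matroid α) : PartialOrder (Flats M) :=
  inferInstanceAs (PartialOrder {F : Set α // M.IsFlat F})

instance {α : Type v} (M : Matroid α) [M.Finite] : Fintype (Flats M) :=
  have : Finite (Flats M) :=
    (M.ground_finite.finite_subsets.subset fun _ hF => hF.subset_ground :
      {F : Set α | M.IsFlat F}.Finite).to_subtype
  Fintype.ofFinite _

/-- The least flat is the closure of the empty set. -/
instance {α : Type v} (M : Matroid α) : OrderBot (Flats M) where
  bot := ⟨M.closure ∅, M.isFlat_closure ∅⟩
  bot_le F := show M.closure ∅ ⊆ F.1 from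
    (M.closure_subset_closure (Set.empty_subset F.1)).trans F.2.closure.subset

/-- The rank of a set in a finite matroid, as a natural number. -/
def rk {α : Type v} (M : Matroid α) (A : Set α) : ℕ := (M.eRk A).toNat

/-- The rank `r(M)` of a finite matroid. -/
def rank {α : Type v} (M : Matroid α) : ℕ := rk M M.E

theorem rk_mono {α : Type v} (M : Matroid α) [M.Finite] {A B : Set α} (h : A ⊆ B) :
    rk M A ≤ rk M B :=
  ENat.toNat_le_toNat (M.eRk_mono h) (M.eRk_ne_top_iff.2 (M.isRkFinite_set B))

/-! ### Immersions and topological representations -/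

/-- A `ρ`-immersion of a matroid `M`: a rank- and order-reversing map `l` from the lattice of flats
to the boolean lattice `B_ρ` on `ρ` elements, that is, `|l(p)| = ρ - r(p)` for every flat `p`
(with `r(p) ≤ ρ`), and `l(q) ⊆ l(p)` whenever `p ≤ q`. -/
structure Immersion {α : Type v} (M : Matroid α) (ρ : ℕ) where
  toFun : Flats M → Finset (Fin ρ)
  antitone : Antitone toFun
  card_add_rk : ∀ p, (toFun p).card + rk M p.1 = ρ

/-- The canonical immersion `p ↦ [ρ - r(p)]`, for `ρ ≥ r(M)`. -/
def canonicalImmersion {α : Type v} (M : Matroid α) [M.Finite] (ρ : ℕ) (hρ : rank M ≤ ρ) :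
    Immersion M ρ where
  toFun p := Finset.univ.filter fun i : Fin ρ => i.val < ρ - rk M p.1
  antitone p q h := by
    have h' : rk M p.1 ≤ rk M q.1 := rk_mono M h
    intro i
    simp only [Finset.mem_filter, Finset.mem_univ, true_and]
    omega
  card_add_rk p := by
    have h' : rk M p.1 ≤ rank M := rk_mono M p.2.subset_ground
    rw [Fin.card_filter_val_lt]
    omega

/-- The `B_ρ`-diagram `D_X`: the space `D_X(σ)` is the join over `i = 1, …, ρ` of the spaces `X`
(if `i ∈ σ`) and `∅` (if `i ∉ σ`), and the maps are the inclusions `D_X(σ) ⊆ D_X(τ)` for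
`σ ⊆ τ`. -/
def booleanDiagram (X : Type u) [TopologicalSpace X] (ρ : ℕ) :
    Finset (Fin ρ) ⥤ TopCat.{u} where
  obj σ := TopCat.of (Join fun i : Fin ρ => {_x : X // i ∈ σ})
  map f := TopCat.ofHom
    ⟨Join.map fun _ x => ⟨x.1, leOfHom f x.2⟩,
      Join.continuous_map fun _ => continuous_subtype_val.subtype_mk _⟩

/-- An immersion as a functor from the opposite of the lattice of flats to `B_ρ`. -/
def Immersion.functor {α : Type v} {M : Matroid α} {ρ : ℕ} (l : Immersion M ρ) :
    (Flats M)ᵒᵖ ⥤ Finset (Fin ρ) where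
  obj p := l.toFun p.unop
  map f := homOfLE (l.antitone (leOfHom f.unop))

/-- The diagram of spaces `D_X(M, l) = D_X ∘ l` over the lattice of flats of `M`. -/
def flatDiagram {α : Type v} {M : Matroid α} {ρ : ℕ} (X : Type u) [TopologicalSpace X]
    (l : Immersion M ρ) : (Flats M)ᵒᵖ ⥤ TopCat.{u} :=
  l.functor ⋙ booleanDiagram X ρ

/-- The topological representation `T_X(M, l)`: the union, over the atoms `a` of the lattice of
flats, of the homotopy colimits of the restrictions of `D_X(M, l)` to the flats above `a`, inside
the homotopy colimit of `D_X(M, l)`. -/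
def rep {α : Type v} {M : Matroid α} [M.Finite] {ρ : ℕ} (X : Type u) [TopologicalSpace X]
    (l : Immersion M ρ) : Set (Hocolim (flatDiagram X l)) :=
  ⋃ a ∈ {a : Flats M | IsAtom a}, hocolimAbove (flatDiagram X l) a

/-- The standard representation `T_X(M)`: the one given by the canonical immersion with
`ρ = r(M)`. -/
def standardRep {α : Type v} (M : Matroid α) [M.Finite] (X : Type u) [TopologicalSpace X] :
    Set (Hocolim (flatDiagram X (canonicalImmersion M (rank M) le_rfl))) :=
  rep X (canonicalImmersion M (rank M) le_rfl)

end MatroidTop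

end

noncomputable section

namespace MatroidTop

open CategoryTheory

universe u v w

/-! ### Generalities on joins -/

section Generalities

variable {Y : Type*} [TopologicalSpace Y]

/-! A point of the homotopy colimit amounts to a pair `(b, x)`, with `b` in the order complex of the
flats and `x` in `X^{*ρ}`, such that the support of `x` lies in `l p` for every `p` in the support
of `b`. The union over the atoms is the part where `b` has no weight at `⊥` (`image_rep`,
`repHomeomorph`).

Rank is strictly monotone on flats, so `l` is strictly antitone and every map `D(p) → D(q)` with `q
< p` misses a factor of the iterated join `D(q)`. Its image lies in the boundary, where some weight
vanishes, and a single homotopy of `D(q)` pushes the whole boundary to a vertex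
(`SubJoin.contract`). The structure maps can therefore be replaced by constant maps to vertices, one
target at a time from the bottom up, without changing the homotopy type
(`ContractingDiagram.nonempty_homotopyEquiv_of_isUpperSet`). What remains involves only the separate
spaces `D(p)` with their vertices, hence only the cardinalities `|l p|`
(`nonempty_homotopyEquiv_realization`).

These cardinalities are also obtained by adding `ρ - r(M)` new indices to every value of the
canonical immersion. For that diagram `x` splits into a point of `X^{*(ρ - r(M))}` and a point of
the standard part, so the homotopy colimit is nearly the desired join. The join merely forgets `b`
where the standard part of `x` has weight zero, which is harmless because the order complex is a
cone with apex the ground flat (`nonempty_homotopyEquiv_suspend`). In rank zero that apex is `⊥` and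
is excluded, but then both sides are empty. -/

theorem continuous_of_locally {E : Type*} [TopologicalSpace E] {f : Y → E}
    (h : ∀ y, ∃ V : Set Y, IsOpen V ∧ y ∈ V ∧ Continuous fun v : V => f v) : Continuous f := by
  rw [continuous_iff_continuousAt]
  intro y
  obtain ⟨V, hV, hy, hc⟩ := h y
  exact (continuousOn_iff_continuous_domRestrict.2 hc).continuousAt (hV.mem_nhds hy)

variable {ι : Type v} [Fintype ι] {Z : ι → Type u}

theorem Join.ext' {z w : Join Z} (hw : ∀ i, z.weight i = w.weight i)
    (hp : ∀ i h h', z.point i h = w.point i h') : z = w := by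
  obtain ⟨a, ha, x⟩ := z
  obtain ⟨b, hb, y⟩ := w
  obtain rfl : a = b := funext hw
  obtain rfl : x = y := by
    funext i h
    exact hp i h h
  rfl

theorem Join.weight_nonneg (z : Join Z) (i : ι) : 0 ≤ z.weight i := z.weight_mem.1 i

theorem Join.sum_weight (z : Join Z) : ∑ i, z.weight i = 1 := z.weight_mem.2

theorem Join.weight_le_one (z : Join Z) (i : ι) : z.weight i ≤ 1 := by
  rw [← z.sum_weight]
  exact Finset.single_le_sum (fun j _ => z.weight_nonneg j) (Finset.mem_univ i)

theorem Join.exists_weight_pos (z : Join Z) : ∃ i, 0 < z.weight i := by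
  by_contra! h
  have := Finset.sum_nonpos fun i (_ : i ∈ Finset.univ) => h i
  rw [z.sum_weight] at this
  linarith

variable [∀ i, TopologicalSpace (Z i)]

theorem Join.continuous_weight (i : ι) : Continuous fun z : Join Z => z.weight i :=
  continuous_def.2 fun U hU =>
    TopologicalSpace.isOpen_generateFrom_of_mem (Or.inl ⟨i, U, hU, rfl⟩)

theorem Join.isOpen_weight_pos (i : ι) : IsOpen {z : Join Z | 0 < z.weight i} :=
  isOpen_lt continuous_const (Join.continuous_weight i)

theorem Join.continuous_point (i : ι) :
    Continuous fun z : {z : Join Z // 0 < z.weight i} => z.1.point i z.2 := by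
  refine continuous_def.2 fun V hV => ?_
  have h : IsOpen {z : Join Z | ∃ h : 0 < z.weight i, z.point i h ∈ V} :=
    TopologicalSpace.isOpen_generateFrom_of_mem (Or.inr ⟨i, V, hV, rfl⟩)
  convert h.preimage continuous_subtype_val using 1
  ext z
  exact ⟨fun hz => ⟨z.2, hz⟩, fun ⟨_, hz⟩ => hz⟩

theorem Join.continuous_point_comp {f : Y → Join Z} (hf : Continuous f) (i : ι)
    (hi : ∀ y, 0 < (f y).weight i) : Continuous fun y => (f y).point i (hi y) :=
  (Join.continuous_point i).comp (hf.subtype_mk hi)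

/-- A point coordinate is tested only on the open set where its weight is positive, so it may behave
arbitrarily as the weight tends to zero. All later maps into joins rely on this. -/
theorem Join.continuous_of {f : Y → Join Z} (hw : ∀ i, Continuous fun y => (f y).weight i)
    (hp : ∀ i, Continuous fun y : {y // 0 < (f y).weight i} => (f y.1).point i y.2) :
    Continuous f := by
  refine continuous_generateFrom_iff.2 ?_
  rintro s (⟨i, U, hU, rfl⟩ | ⟨i, V, hV, rfl⟩)
  · exact hU.preimage (hw i)
  · have ho : IsOpen {y | 0 < (f y).weight i} := isOpen_lt continuous_const (hw i)
    have := ho.isOpenMap_subtype_val _ (hV.preimage (hp i))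
    convert this using 1
    ext y
    constructor
    · rintro ⟨h, hy⟩
      exact ⟨⟨y, h⟩, hy, rfl⟩
    · rintro ⟨⟨y, h⟩, hy, rfl⟩
      exact ⟨h, hy⟩

/-- Homeomorphisms of the factors induce a homeomorphism of joins. -/
def Join.homeomorph {W : ι → Type w} [∀ i, TopologicalSpace (W i)] (e : ∀ i, Z i ≃ₜ W i) :
    Join Z ≃ₜ Join W where
  toFun := Join.map fun i => e i
  invFun := Join.map fun i => (e i).symm
  left_inv _ := Join.ext' (fun _ => rfl) fun i _ _ => (e i).symm_apply_apply _
  right_inv _ := Join.ext' (fun _ => rfl) fun i _ _ => (e i).apply_symm_apply _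
  continuous_toFun := Join.continuous_map fun i => (e i).continuous
  continuous_invFun := Join.continuous_map fun i => (e i).symm.continuous

/-- The point of a join with prescribed nonzero unnormalized weights. -/
def Join.normalize (a : ι → ℝ) (h0 : ∀ i, 0 ≤ a i) (h1 : 0 < ∑ i, a i)
    (x : ∀ i, 0 < a i → Z i) : Join Z where
  weight i := a i / ∑ j, a j
  weight_mem := ⟨fun i => div_nonneg (h0 i) h1.le, by
    rw [← Finset.sum_div, div_self h1.ne']⟩
  point i h := x i ((div_pos_iff_of_pos_right h1).1 h)

theorem Join.continuous_normalize {a : Y → ι → ℝ} {h0 : ∀ y i, 0 ≤ a y i}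
    {h1 : ∀ y, 0 < ∑ i, a y i} {x : ∀ y i, 0 < a y i → Z i}
    (ha : ∀ i, Continuous fun y => a y i)
    (hx : ∀ i, Continuous fun y : {y // 0 < a y i} => x y.1 i y.2) :
    Continuous fun y => Join.normalize (a y) (h0 y) (h1 y) (x y) := by
  refine Join.continuous_of (fun i => ?_) fun i => ?_
  · exact (ha i).div (continuous_finsetSum _ fun j _ => ha j) fun y => (h1 y).ne'
  · have : Continuous fun y : {y // 0 < (Join.normalize (a y) (h0 y) (h1 y) (x y)).weight i} =>
        (⟨y.1, (div_pos_iff_of_pos_right (h1 y.1)).1 y.2⟩ : {y // 0 < a y i}) :=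
      continuous_subtype_val.subtype_mk _
    exact (hx i).comp this

/-- Homotopies are written over the whole real line, so that times such as `2 * s - 1` need no
membership proof. -/
theorem homotopic_of_continuous {E : Type*} [TopologicalSpace E] {f g : C(Y, E)}
    (F : ℝ × Y → E) (hF : Continuous F) (h0 : ∀ y, F (0, y) = f y) (h1 : ∀ y, F (1, y) = g y) :
    f.Homotopic g :=
  ⟨{ toFun := fun q => F (q.1, q.2)
     continuous_toFun := hF.comp
      ((continuous_subtype_val.comp continuous_fst).prodMk continuous_snd)
     map_zero_left := fun y => by simpa using h0 y
     map_one_left := fun y => by simpa using h1 y }⟩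

theorem nonempty_homotopyEquiv_of_isEmpty {E F : Type*} [TopologicalSpace E] [TopologicalSpace F]
    [IsEmpty E] [IsEmpty F] : Nonempty (ContinuousMap.HomotopyEquiv E F) :=
  ⟨(Homeomorph.empty : E ≃ₜ F).toHomotopyEquiv⟩

end Generalities

/-! ### Pushing the boundary of an iterated join to a vertex -/

/-- The retraction of the real line onto the unit interval. -/
def clip (x : ℝ) : ℝ := max 0 (min 1 x)

theorem continuous_clip : Continuous clip := by unfold clip; fun_prop

theorem clip_nonneg (x : ℝ) : 0 ≤ clip x := le_max_left _ _

theorem clip_le_one (x : ℝ) : clip x ≤ 1 := max_le zero_le_one (min_le_left _ _)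

theorem clip_of_nonpos {x : ℝ} (h : x ≤ 0) : clip x = 0 :=
  max_eq_left ((min_le_right _ _).trans h)

theorem clip_of_one_le {x : ℝ} (h : 1 ≤ x) : clip x = 1 := by
  rw [clip, min_eq_left h, max_eq_right zero_le_one]

theorem clip_of_mem {x : ℝ} (h : 0 ≤ x) (h' : x ≤ 1) : clip x = x := by
  rw [clip, min_eq_right h', max_eq_right h]

/-- The join over `i ∈ ι` of the spaces `X`, if `i ∈ B`, and `∅`, if `i ∉ B`. -/
abbrev SubJoin (X : Type u) {ι : Type v} [Fintype ι] (B : Set ι) : Type (max u v) :=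
  Join (fun i : ι => {_x : X // i ∈ B})

namespace SubJoin

variable {X : Type u} {ι : Type v} [Fintype ι] {B : Set ι}

theorem mem_of_pos (x : SubJoin X B) {i : ι} (h : 0 < x.weight i) : i ∈ B := (x.point i h).2

/-- A positive real which is smaller than the largest weight of every point. -/
def eps (ι : Type v) [Fintype ι] : ℝ := 1 / (2 * Fintype.card ι + 2)

theorem eps_pos : 0 < eps ι := by unfold eps; positivity

/-- Lowering every weight by `eps` cannot exhaust the total weight `1`. -/
theorem card_mul_eps_lt : Fintype.card ι * eps ι < 1 := by
  unfold eps
  rw [mul_one_div, div_lt_one (by positivity)]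
  have : (0 : ℝ) ≤ Fintype.card ι := by positivity
  linarith

open Classical in
/-- The amount by which the weight of `i ∈ B` fails to reach `eps`. -/
def defect (x : SubJoin X B) (i : ι) : ℝ := if i ∈ B then max (eps ι - x.weight i) 0 else 0

/-- The total defect. -/
def gap (x : SubJoin X B) : ℝ := ∑ i, defect x i

theorem defect_nonneg (x : SubJoin X B) (i : ι) : 0 ≤ defect x i := by
  unfold defect
  split_ifs
  exacts [le_max_right _ _, le_rfl]

theorem eps_le_gap (x : SubJoin X B) {i : ι} (hi : i ∈ B) (h : x.weight i = 0) :
    eps ι ≤ gap x := by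
  refine le_trans ?_ (Finset.single_le_sum (fun j _ => defect_nonneg x j) (Finset.mem_univ i))
  rw [defect, if_pos hi, h]
  simp

/-- A function which is `1` when the gap is at least `eps / 2` and `0` when the gap vanishes. -/
def outer (x : SubJoin X B) : ℝ := clip (2 * gap x / eps ι)

/-- A function which is `1` when the gap is at least `eps` and `0` when it is at most `eps / 2`. -/
def inner (x : SubJoin X B) : ℝ := clip (2 * gap x / eps ι - 1)

theorem outer_of_inner_pos (x : SubJoin X B) (h : 0 < inner x) : outer x = 1 := by
  refine clip_of_one_le ?_
  by_contra! h'
  rw [inner, clip_of_nonpos (by linarith)] at h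
  exact h.false

theorem gap_pos_of_outer_pos (x : SubJoin X B) (h : 0 < outer x) : 0 < gap x := by
  by_contra! h'
  rw [outer, clip_of_nonpos (div_nonpos_of_nonpos_of_nonneg (by linarith) eps_pos.le)] at h
  exact h.false

theorem inner_of_eps_le (x : SubJoin X B) (h : eps ι ≤ gap x) : inner x = 1 := by
  refine clip_of_one_le ?_
  have : 2 ≤ 2 * gap x / eps ι := by
    rw [le_div_iff₀ eps_pos]
    linarith
  linarith

/-- The part of the unnormalized weights of `contract` that is carried by the original point. -/
def oldPart (t : ℝ) (x : SubJoin X B) (i : ι) : ℝ :=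
  (1 - clip (6 * t - 1) * outer x) * max (x.weight i - clip (6 * t) * eps ι) 0

open Classical in
/-- The part of the unnormalized weights of `contract` that is carried by the base point. -/
def newPart (i₀ : ι) (t : ℝ) (x : SubJoin X B) (i : ι) : ℝ :=
  clip (6 * t - 1) * outer x * ((1 - clip (6 * t - 2) * inner x) * defect x i +
    clip (6 * t - 2) * inner x * if i = i₀ then 1 else 0)

theorem oldPart_coeff_nonneg (t : ℝ) (x : SubJoin X B) : 0 ≤ 1 - clip (6 * t - 1) * outer x :=
  sub_nonneg.2 (mul_le_one₀ (clip_le_one _) (clip_nonneg _) (clip_le_one _))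

theorem newPart_coeff_nonneg (t : ℝ) (x : SubJoin X B) : 0 ≤ 1 - clip (6 * t - 2) * inner x :=
  sub_nonneg.2 (mul_le_one₀ (clip_le_one _) (clip_nonneg _) (clip_le_one _))

theorem oldPart_nonneg (t : ℝ) (x : SubJoin X B) (i : ι) : 0 ≤ oldPart t x i :=
  mul_nonneg (oldPart_coeff_nonneg t x) (le_max_right _ _)

theorem newPart_nonneg (i₀ : ι) (t : ℝ) (x : SubJoin X B) (i : ι) : 0 ≤ newPart i₀ t x i := by
  refine mul_nonneg (mul_nonneg (clip_nonneg _) (clip_nonneg _)) (add_nonneg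
    (mul_nonneg (newPart_coeff_nonneg t x) (defect_nonneg x i))
    (mul_nonneg (mul_nonneg (clip_nonneg _) (clip_nonneg _)) ?_))
  split_ifs <;> norm_num

theorem weight_pos_of_oldPart_pos {t : ℝ} {x : SubJoin X B} {i : ι} (h : 0 < oldPart t x i) :
    0 < x.weight i := by
  by_contra! h'
  rw [oldPart, max_eq_right, mul_zero] at h
  · exact h.false
  · have := mul_nonneg (clip_nonneg (6 * t)) (eps_pos (ι := ι)).le
    linarith

theorem mem_of_newPart_pos {i₀ : ι} (hi₀ : i₀ ∈ B) {t : ℝ} {x : SubJoin X B} {i : ι}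
    (h : 0 < newPart i₀ t x i) : i ∈ B := by
  by_contra h'
  have hne : i ≠ i₀ := fun e => h' (e ▸ hi₀)
  simp [newPart, defect, h', hne] at h

/-- The homotopy has three stages. Until time `1/6` the weights are truncated by `eps`, which
empties the factors of weight at most `eps`. Until `1/3` mass passes, where the gap is positive, to
the base point in factors emptied before. Until `1/2`, and only where `inner` is positive so that
the old part has died, the mass is gathered at `i₀`. Thus no factor ever carries old and new mass
together, and this makes the point coordinates of `contract` continuous. -/
theorem oldPart_eq_zero {i₀ : ι} {t : ℝ} {x : SubJoin X B} {i : ι}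
    (h : 0 < newPart i₀ t x i) : oldPart t x i = 0 := by
  have h2 : clip (6 * t - 1) ≠ 0 := fun e => by simp [newPart, e] at h
  have h1 : clip (6 * t) = 1 := by
    refine clip_of_one_le ?_
    by_contra! h'
    exact h2 (clip_of_nonpos (by linarith))
  by_cases h3 : clip (6 * t - 2) * inner x = 0
  · have hd : 0 < defect x i := by
      refine (defect_nonneg x i).lt_of_ne' fun e => ?_
      simp [newPart, e, h3] at h
    have : x.weight i ≤ eps ι := by
      unfold defect at hd
      split_ifs at hd
      · by_contra! h'
        rw [max_eq_right (by linarith)] at hd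
        exact hd.false
      · exact absurd hd (lt_irrefl _)
    rw [oldPart, h1, max_eq_right (by linarith), mul_zero]
  · have ho : outer x = 1 := outer_of_inner_pos x
      ((clip_nonneg _).lt_of_ne' fun e => h3 (by rw [inner, e, mul_zero]))
    have h4 : clip (6 * t - 1) = 1 := by
      refine clip_of_one_le ?_
      by_contra! h'
      exact h3 (by rw [clip_of_nonpos (by linarith), zero_mul])
    rw [oldPart, ho, h4]
    simp

theorem sum_newPart (i₀ : ι) (t : ℝ) (x : SubJoin X B) : ∑ i, newPart i₀ t x i =
    clip (6 * t - 1) * outer x * ((1 - clip (6 * t - 2) * inner x) * gap x +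
      clip (6 * t - 2) * inner x) := by
  simp only [newPart, ← Finset.mul_sum, Finset.sum_add_distrib, gap]
  rw [Finset.sum_eq_single i₀ (fun j _ hj => if_neg hj) fun h => absurd (Finset.mem_univ _) h,
    if_pos rfl, mul_one]

/-- Either the coefficient of the old part is positive, and truncation leaves at least `1 - n * eps`
for `n` factors; or that coefficient vanishes, which forces a positive gap and hence a positive new
part. -/
theorem sum_pos (i₀ : ι) (t : ℝ) (x : SubJoin X B) :
    0 < ∑ i, (oldPart t x i + newPart i₀ t x i) := by
  rw [Finset.sum_add_distrib]
  have hn := Finset.sum_nonneg fun i (_ : i ∈ Finset.univ) => newPart_nonneg i₀ t x i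
  have ho := Finset.sum_nonneg fun i (_ : i ∈ Finset.univ) => oldPart_nonneg t x i
  rcases (oldPart_coeff_nonneg t x).lt_or_eq with h | h
  · refine add_pos_of_pos_of_nonneg ?_ hn
    simp only [oldPart, ← Finset.mul_sum]
    refine mul_pos h ?_
    have : ∑ i, (x.weight i - eps ι) ≤ ∑ i, max (x.weight i - clip (6 * t) * eps ι) 0 := by
      refine Finset.sum_le_sum fun i _ => le_max_of_le_left ?_
      have := mul_le_of_le_one_left (eps_pos (ι := ι)).le (clip_le_one (6 * t))
      linarith
    refine lt_of_lt_of_le ?_ this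
    rw [Finset.sum_sub_distrib, x.sum_weight, Finset.sum_const, nsmul_eq_mul, Finset.card_univ]
    linarith [card_mul_eps_lt (ι := ι)]
  · refine add_pos_of_nonneg_of_pos ho ?_
    have h1 : clip (6 * t - 1) * outer x = 1 := by linarith
    have hg : 0 < gap x := by
      refine gap_pos_of_outer_pos x ((clip_nonneg _).lt_of_ne' fun e => ?_)
      rw [outer, e, mul_zero] at h1
      exact zero_ne_one h1
    rw [sum_newPart, h1, one_mul]
    rcases (newPart_coeff_nonneg t x).lt_or_eq with h' | h'
    · exact add_pos_of_pos_of_nonneg (mul_pos h' hg) (mul_nonneg (clip_nonneg _) (clip_nonneg _))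
    · rw [← h']
      linarith

open Classical in
/-- A homotopy of `SubJoin X B`, parametrized by the real line, which is the identity at time `0`
and which from time `1 / 2` on sends the boundary to the vertex `x₀` of the factor `i₀`. -/
def contract {i₀ : ι} (hi₀ : i₀ ∈ B) (x₀ : X) (t : ℝ) (x : SubJoin X B) : SubJoin X B :=
  Join.normalize (fun i => oldPart t x i + newPart i₀ t x i)
    (fun i => add_nonneg (oldPart_nonneg t x i) (newPart_nonneg i₀ t x i)) (sum_pos i₀ t x)
    fun i h => if h' : 0 < oldPart t x i then x.point i (weight_pos_of_oldPart_pos h') else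
      ⟨x₀, mem_of_newPart_pos (t := t) (x := x) hi₀
        (by linarith [le_antisymm (not_lt.1 h') (oldPart_nonneg t x i)])⟩

theorem contract_zero {i₀ : ι} (hi₀ : i₀ ∈ B) (x₀ : X) (x : SubJoin X B) :
    contract hi₀ x₀ 0 x = x := by
  have h0 : ∀ i, oldPart 0 x i = x.weight i := fun i => by
    simp [oldPart, clip_of_nonpos, x.weight_nonneg i]
  have h1 : ∀ i, newPart i₀ 0 x i = 0 := fun i => by
    simp [newPart, clip_of_nonpos]
  refine Join.ext' (fun i => ?_) fun i h h' => ?_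
  · simp [contract, Join.normalize, h0, h1, x.sum_weight]
  · simp [contract, Join.normalize, h0, h']

open Classical in
/-- The vertex `x₀` of the factor `i₀`. -/
def vertex {i₀ : ι} (hi₀ : i₀ ∈ B) (x₀ : X) : SubJoin X B where
  weight := Pi.single i₀ 1
  weight_mem := single_mem_stdSimplex ℝ i₀
  point i h := ⟨x₀, by
    by_cases e : i = i₀
    · exact e ▸ hi₀
    · rw [Pi.single_eq_of_ne e] at h
      exact absurd h (lt_irrefl _)⟩

/-- A vanishing weight makes the gap at least `eps`, where both cutoffs equal `1`; from time `1/2`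
on all three stages are complete. -/
theorem contract_of_weight_eq_zero {i₀ : ι} (hi₀ : i₀ ∈ B) (x₀ : X) {t : ℝ} (ht : 1 / 2 ≤ t)
    {x : SubJoin X B} {i : ι} (hi : i ∈ B) (hx : x.weight i = 0) :
    contract hi₀ x₀ t x = vertex hi₀ x₀ := by
  have hin : inner x = 1 := inner_of_eps_le x (eps_le_gap x hi hx)
  have hout : outer x = 1 := outer_of_inner_pos x (by rw [hin]; exact one_pos)
  have h0 : ∀ i, oldPart t x i = 0 := fun i => by
    rw [oldPart, hout, clip_of_one_le (by linarith)]
    simp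
  have h1 : ∀ i, newPart i₀ t x i = (vertex hi₀ x₀).weight i := fun i => by
    rw [newPart, hout, hin, clip_of_one_le (by linarith), clip_of_one_le (by linarith)]
    simp [vertex, Pi.single_apply]
  refine Join.ext' (fun i => ?_) fun i h h' => ?_
  · simp [contract, Join.normalize, h0, h1, (vertex hi₀ x₀).sum_weight]
  · simp [contract, Join.normalize, h0, vertex]

variable [TopologicalSpace X]

theorem continuous_defect (i : ι) : Continuous fun x : SubJoin X B => defect x i := by
  have := Join.continuous_weight (Z := fun i : ι => {_x : X // i ∈ B}) i
  unfold defect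
  split_ifs <;> fun_prop

theorem continuous_gap : Continuous (gap : SubJoin X B → ℝ) :=
  continuous_finsetSum _ fun i _ => continuous_defect i

theorem continuous_outer : Continuous (outer : SubJoin X B → ℝ) :=
  continuous_clip.comp ((continuous_const.mul continuous_gap).div_const _)

theorem continuous_inner : Continuous (inner : SubJoin X B → ℝ) :=
  continuous_clip.comp (((continuous_const.mul continuous_gap).div_const _).sub continuous_const)

theorem continuous_oldPart (i : ι) :
    Continuous fun q : ℝ × SubJoin X B => oldPart q.1 q.2 i := by
  have h1 := Join.continuous_weight (Z := fun i : ι => {_x : X // i ∈ B}) i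
  have h2 := continuous_outer (X := X) (B := B)
  have h3 := continuous_clip
  unfold oldPart
  fun_prop

theorem continuous_newPart (i₀ i : ι) :
    Continuous fun q : ℝ × SubJoin X B => newPart i₀ q.1 q.2 i := by
  have h1 := continuous_defect (X := X) (B := B) i
  have h2 := continuous_outer (X := X) (B := B)
  have h3 := continuous_inner (X := X) (B := B)
  have h4 := continuous_clip
  unfold newPart
  fun_prop

theorem continuous_contract {i₀ : ι} (hi₀ : i₀ ∈ B) (x₀ : X) :
    Continuous fun q : ℝ × SubJoin X B => contract hi₀ x₀ q.1 q.2 := by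
  refine Join.continuous_normalize
    (fun i => (continuous_oldPart i).add (continuous_newPart i₀ i)) fun i => ?_
  -- Near each point of the domain either the old part or the new part stays positive, and there the
  -- coordinate is the original one or constantly `x₀`.
  refine continuous_of_locally fun q => ?_
  by_cases h : 0 < oldPart q.1.1 q.1.2 i
  · refine ⟨{q | 0 < oldPart q.1.1 q.1.2 i}, isOpen_lt continuous_const
      ((continuous_oldPart i).comp continuous_subtype_val), h, ?_⟩
    have : Continuous fun v : {q : {q : ℝ × SubJoin X B //
        0 < oldPart q.1 q.2 i + newPart i₀ q.1 q.2 i} | 0 < oldPart q.1.1 q.1.2 i} =>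
        v.1.1.2.point i (weight_pos_of_oldPart_pos v.2) :=
      Join.continuous_point_comp (f := fun v : {q : {q : ℝ × SubJoin X B //
        0 < oldPart q.1 q.2 i + newPart i₀ q.1 q.2 i} | 0 < oldPart q.1.1 q.1.2 i} => v.1.1.2)
        (by fun_prop) i _
    convert this using 2 with v
    exact dif_pos v.2
  · have h' : 0 < newPart i₀ q.1.1 q.1.2 i := by
      linarith [q.2, not_lt.1 h]
    refine ⟨{q | 0 < newPart i₀ q.1.1 q.1.2 i}, isOpen_lt continuous_const
      ((continuous_newPart i₀ i).comp continuous_subtype_val), h', ?_⟩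
    have hi : i ∈ B := mem_of_newPart_pos hi₀ h'
    have : Continuous fun _ : {q : {q : ℝ × SubJoin X B //
        0 < oldPart q.1 q.2 i + newPart i₀ q.1 q.2 i} | 0 < newPart i₀ q.1.1 q.1.2 i} =>
        (⟨x₀, hi⟩ : {_x : X // i ∈ B}) := continuous_const
    convert this using 2 with v
    exact dif_neg (by rw [oldPart_eq_zero v.2]; exact lt_irrefl _)

end SubJoin

/-! ### Replacing null-homotopic structure maps by constant ones -/

/-- Spaces `D p`, indexed by a poset, with compatible maps `D p → D q` for `q ≤ p`, each of which,
if `q < p`, is contracted to a point not depending on `p` by a homotopy of `D q`. -/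
structure ContractingDiagram (P : Type v) [PartialOrder P] where
  obj : P → Type u
  [top : ∀ p, TopologicalSpace (obj p)]
  map : ∀ {p q : P}, q ≤ p → obj p → obj q
  continuous_map : ∀ {p q : P} (h : q ≤ p), Continuous (map h)
  map_map : ∀ {p q r : P} (h : q ≤ p) (h' : r ≤ q) (x : obj p),
    map h' (map h x) = map (h'.trans h) x
  pull : ∀ p : P, ℝ → obj p → obj p
  continuous_pull : ∀ p : P, Continuous fun x : ℝ × obj p => pull p x.1 x.2
  pull_zero : ∀ (p : P) (x : obj p), pull p 0 x = x
  pull_map : ∀ {m p p' : P} (h : m < p) (h' : m < p') (x : obj p) (x' : obj p') {t t' : ℝ},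
    1 / 2 ≤ t → 1 / 2 ≤ t' → pull m t (map h.le x) = pull m t' (map h'.le x')

attribute [instance] ContractingDiagram.top

/-! ### Moving weight from above an element onto it -/

section Shift

variable {P : Type v} [PartialOrder P]

open Classical in
/-- The part of the weight of `p` that `shift` moves to `m`. -/
def moved (m : P) (w : P → ℝ) (p : P) : ℝ := if m < p then min (w p) (w m) else 0

variable {m : P} {w : P → ℝ}

theorem continuous_moved (m p : P) : Continuous fun w : P → ℝ => moved m w p := by
  unfold moved
  split_ifs <;> fun_prop

theorem moved_nonneg (hw : ∀ p, 0 ≤ w p) (p : P) : 0 ≤ moved m w p := by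
  unfold moved
  split_ifs
  exacts [le_min (hw p) (hw m), le_rfl]

theorem moved_le (hw : ∀ p, 0 ≤ w p) (p : P) : moved m w p ≤ w p := by
  unfold moved
  split_ifs
  exacts [min_le_left _ _, hw p]

variable [Fintype P]

open Classical in
/-- Move weight from the elements above `m` to `m`. -/
def shift (m : P) (w : P → ℝ) (p : P) : ℝ :=
  w p - moved m w p + if p = m then ∑ q, moved m w q else 0

open Classical in
/-- The total weight above `m`. -/
def above (m : P) (w : P → ℝ) : ℝ := ∑ p, if m < p then w p else 0

theorem continuous_shift (m : P) : Continuous (shift m) := by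
  have := continuous_moved m
  refine continuous_pi fun p => ?_
  unfold shift
  split_ifs <;> fun_prop

theorem continuous_above (m : P) : Continuous (above m) := by
  refine continuous_finsetSum _ fun p _ => ?_
  split_ifs <;> fun_prop

theorem shift_mem (hw : w ∈ stdSimplex ℝ P) : shift m w ∈ stdSimplex ℝ P := by
  refine ⟨fun p => ?_, ?_⟩
  · refine add_nonneg (sub_nonneg.2 (moved_le hw.1 p)) ?_
    split_ifs
    exacts [Finset.sum_nonneg fun q _ => moved_nonneg hw.1 q, le_rfl]
  · simp only [shift, Finset.sum_add_distrib, Finset.sum_sub_distrib, hw.2]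
    rw [Finset.sum_eq_single m (fun j _ hj => if_neg hj) fun h => absurd (Finset.mem_univ _) h,
      if_pos rfl]
    ring

/-- The amounts moved are at most `w m`, so `m` receives nothing unless it already has weight:
shifting never enlarges the support. -/
theorem pos_of_shift_pos (hw : ∀ p, 0 ≤ w p) {p : P} (h : 0 < shift m w p) : 0 < w p := by
  refine (hw p).lt_of_ne' fun e => ?_
  have h1 : moved m w p = 0 := le_antisymm (e ▸ moved_le hw p) (moved_nonneg hw p)
  rw [shift, e, h1, sub_zero, zero_add] at h
  split_ifs at h with hp
  · subst hp
    refine h.ne' (Finset.sum_eq_zero fun q _ => ?_)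
    unfold moved
    split_ifs
    exacts [by rw [e]; exact min_eq_right (hw q), rfl]
  · exact h.false

theorem shift_self_pos (hw : ∀ p, 0 ≤ w p) (h : 0 < w m) : 0 < shift m w m := by
  rw [shift, if_pos rfl, moved, if_neg (lt_irrefl m), sub_zero]
  exact add_pos_of_pos_of_nonneg h (Finset.sum_nonneg fun q _ => moved_nonneg hw q)

theorem above_nonneg (hw : ∀ p, 0 ≤ w p) : 0 ≤ above m w :=
  Finset.sum_nonneg fun p _ => by
    split_ifs
    exacts [hw p, le_rfl]

theorem le_above (hw : ∀ p, 0 ≤ w p) {p : P} (hp : m < p) : w p ≤ above m w := by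
  classical
  refine le_trans (by rw [if_pos hp]) (Finset.single_le_sum
    (f := fun p => if m < p then w p else 0) (fun q _ => ?_) (Finset.mem_univ p))
  show 0 ≤ ite _ _ _
  split_ifs
  exacts [hw q, le_rfl]

theorem exists_of_above_pos (h : 0 < above m w) : ∃ p, m < p ∧ 0 < w p := by
  by_contra! h'
  refine h.not_ge (Finset.sum_nonpos fun p _ => ?_)
  split_ifs with hp
  exacts [h' p hp, le_rfl]

/-- Shifting removes `min (w p) (w m)` from `p`, so weight survives there only if `w p > w m`. This
is the purpose of the shift: wherever `m` and something above it both survive, times clipped at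
ratio `1` have reached their end. -/
theorem one_lt_ratio_of_shift_pos (hw : ∀ p, 0 ≤ w p) (hm : 0 < w m) {p : P} (hp : m < p)
    (h : 0 < shift m w p) : 1 < above m w / w m := by
  rw [one_lt_div hm]
  refine lt_of_lt_of_le ?_ (le_above hw hp)
  by_contra! h'
  rw [shift, if_neg hp.ne', moved, if_pos hp, min_eq_left h'] at h
  simp at h

theorem one_lt_ratio_of_above_shift_pos (hw : ∀ p, 0 ≤ w p) (hm : 0 < w m)
    (h : 0 < above m (shift m w)) : 1 < above m w / w m := by
  obtain ⟨p, hp, h'⟩ := exists_of_above_pos h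
  exact one_lt_ratio_of_shift_pos hw hm hp h'

end Shift

/-! ### Changing the weights and one factor of a point of a join -/

section Modify

variable {P : Type v} [Fintype P] {Z : P → Type u}

open Classical in
/-- Change the weights of a point of a join, and the point of the factor `m`. -/
def Join.modify (m : P) (z : Join Z) (w : P → ℝ) (hw : w ∈ stdSimplex ℝ P)
    (hs : ∀ p, 0 < w p → 0 < z.weight p) (y : 0 < z.weight m → Z m) : Join Z where
  weight := w
  weight_mem := hw
  point p h := if e : m = p then e ▸ y (e ▸ hs p h) else z.point p (hs p h)

variable {m : P}

theorem Join.modify_point_self {z : Join Z} {w : P → ℝ} {hw : w ∈ stdSimplex ℝ P}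
    {hs : ∀ p, 0 < w p → 0 < z.weight p} {y : 0 < z.weight m → Z m}
    (h : 0 < (z.modify m w hw hs y).weight m) : (z.modify m w hw hs y).point m h = y (hs m h) := by
  simp [Join.modify]

theorem Join.modify_point_of_ne {z : Join Z} {w : P → ℝ} {hw : w ∈ stdSimplex ℝ P}
    {hs : ∀ p, 0 < w p → 0 < z.weight p} {y : 0 < z.weight m → Z m} {p : P} (hp : m ≠ p)
    (h : 0 < (z.modify m w hw hs y).weight p) :
    (z.modify m w hw hs y).point p h = z.point p (hs p h) := by
  simp [Join.modify, hp]

theorem Join.continuous_modify [∀ p, TopologicalSpace (Z p)] {Y : Type*} [TopologicalSpace Y]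
    {f : Y → Join Z} (hf : Continuous f) {w : Y → P → ℝ} (hwc : Continuous w)
    {hw : ∀ v, w v ∈ stdSimplex ℝ P} {hs : ∀ v p, 0 < w v p → 0 < (f v).weight p}
    {y : ∀ v, 0 < (f v).weight m → Z m}
    (hy : Continuous fun v : {v // 0 < (f v).weight m} => y v.1 v.2) :
    Continuous fun v => (f v).modify m (w v) (hw v) (hs v) (y v) := by
  refine Join.continuous_of (fun p => (continuous_apply p).comp hwc) fun p => ?_
  by_cases e : m = p
  · subst e
    simp only [Join.modify_point_self]
    exact hy.comp (continuous_subtype_val.subtype_mk fun v => hs v.1 m v.2)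
  · simp only [Join.modify_point_of_ne e]
    exact Join.continuous_point_comp (hf.comp continuous_subtype_val) p fun v => hs v.1 p v.2

end Modify

/-! ### Homotopy colimits with some structure maps made constant -/

namespace ContractingDiagram

variable {P : Type v} [PartialOrder P] [Fintype P] (D : ContractingDiagram.{u} P)

/-- The homotopy colimit, as a subspace of the join of all spaces, of the restriction to `A` of the
diagram that is obtained from `D` by making constant all maps to `D q`, for `q ∉ S`. -/
def colim (A S : Set P) : Set (Join D.obj) :=
  {z | (∀ p, 0 < z.weight p → p ∈ A) ∧ IsChain (· ≤ ·) {p | 0 < z.weight p} ∧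
    ∀ (p q : P) (h : q < p) (hp : 0 < z.weight p) (hq : 0 < z.weight q),
      (q ∈ S → z.point q hq = D.map h.le (z.point p hp)) ∧
      (q ∉ S → z.point q hq = D.pull q 1 (D.map h.le (z.point p hp)))}

variable {D} {A S : Set P} {m : P}

/-- Only relations into `m` from above need checking: the maps from `m` to lower elements are
already constant and do not see the new point at `m`. -/
theorem modify_mem_colim {S' : Set P} (hS : ∀ p, p ≠ m → (p ∈ S ↔ p ∈ S')) (hlow : ∀ q < m, q ∉ S)
    {z : Join D.obj} (hz : z ∈ D.colim A S) {w : P → ℝ} (hw : w ∈ stdSimplex ℝ P)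
    (hs : ∀ p, 0 < w p → 0 < z.weight p) {y : 0 < z.weight m → D.obj m}
    (hy : ∀ (p : P) (h : m < p) (hp : 0 < w p) (hm : 0 < w m),
      (m ∈ S' → y (hs m hm) = D.map h.le (z.point p (hs p hp))) ∧
      (m ∉ S' → y (hs m hm) = D.pull m 1 (D.map h.le (z.point p (hs p hp))))) :
    z.modify m w hw hs y ∈ D.colim A S' := by
  refine ⟨fun p hp => hz.1 p (hs p hp), hz.2.1.mono fun p hp => hs p hp, fun p q h hp hq => ?_⟩
  by_cases hqm : m = q
  · subst hqm
    rw [Join.modify_point_self, Join.modify_point_of_ne h.ne]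
    exact hy p h hp hq
  rw [Join.modify_point_of_ne hqm]
  by_cases hpm : m = p
  · subst hpm
    rw [Join.modify_point_self, ← hS q h.ne]
    refine ⟨fun hq' => absurd hq' (hlow q h), fun hq' => ?_⟩
    rw [(hz.2.2 m q h (hs m hp) (hs q hq)).2 hq']
    exact D.pull_map h h _ _ (by norm_num) (by norm_num)
  · rw [Join.modify_point_of_ne hpm, ← hS q (Ne.symm hqm)]
    exact hz.2.2 p q h (hs p hp) (hs q hq)

/-- The image in `D m` of the points of a join above `m`. -/
def upper (m : P) (z : Join D.obj) (h : 0 < above m z.weight) : D.obj m :=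
  D.map (exists_of_above_pos h).choose_spec.1.le
    (z.point (exists_of_above_pos h).choose (exists_of_above_pos h).choose_spec.2)

/-- The maps between elements above `m` are still the original ones, so all points above `m` have
the same image in `D m` and the choice in `upper` is immaterial. -/
theorem upper_eq (hup : ∀ p, m < p → p ∈ S) {z : Join D.obj} (hz : z ∈ D.colim A S)
    (h : 0 < above m z.weight) {p : P} (hp : m < p) (hp' : 0 < z.weight p) :
    upper m z h = D.map hp.le (z.point p hp') := by
  unfold upper
  have hq := (exists_of_above_pos h).choose_spec
  generalize_proofs _ h1 h2
  generalize (exists_of_above_pos h).choose = q at *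
  by_cases e : q = p
  · subst e
    rfl
  · rcases hz.2.1 h2 hp' e with hle | hle
    · rw [(hz.2.2 p q (lt_of_le_of_ne hle e) hp' h2).1 (hup q hq.1), D.map_map]
    · rw [(hz.2.2 q p (lt_of_le_of_ne hle (Ne.symm e)) h2 hp').1 (hup p hp), D.map_map]

open Classical in
/-- The point of `D m` given by the points above `m`, pulled to time `t`, if there are such. -/
def pulledTop (m : P) (t : ℝ) (z : Join D.obj) (hm : 0 < z.weight m) : D.obj m :=
  if h : 0 < above m z.weight then D.pull m t (upper m z h) else z.point m hm

theorem pulledTop_of_pos (hup : ∀ p, m < p → p ∈ S) {z : Join D.obj} (hz : z ∈ D.colim A S)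
    {t : ℝ} (hm : 0 < z.weight m) {p : P} (hp : m < p) (hp' : 0 < z.weight p) :
    pulledTop m t z hm = D.pull m t (D.map hp.le (z.point p hp')) := by
  have h : 0 < above m z.weight := hp'.trans_le (le_above z.weight_nonneg hp)
  rw [pulledTop, dif_pos h, upper_eq hup hz h hp hp']

/-- From time `1/2` on the pulled image is the constant value that the relation for `m ∉ S`
prescribes at `m`, so both branches of `pulledTop` agree. -/
theorem pulledTop_eq_point (hup : ∀ p, m < p → p ∈ S) (hmS : m ∉ S) {z : Join D.obj}
    (hz : z ∈ D.colim A S) {t : ℝ} (ht : 1 / 2 ≤ t) (hm : 0 < z.weight m) :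
    pulledTop m t z hm = z.point m hm := by
  by_cases h : 0 < above m z.weight
  · obtain ⟨p, hp, hp'⟩ := exists_of_above_pos h
    rw [pulledTop_of_pos hup hz hm hp hp', (hz.2.2 p m hp hp' hm).2 hmS]
    exact D.pull_map hp hp _ _ ht (by norm_num)
  · rw [pulledTop, dif_neg h]

variable {Y : Type*} [TopologicalSpace Y]

theorem continuous_weight_comp {f : Y → Join D.obj} (hf : Continuous f) :
    Continuous fun v => (f v).weight :=
  continuous_pi fun p => (Join.continuous_weight p).comp hf

theorem continuous_ratio {f : Y → P → ℝ} (hf : Continuous f) (h : ∀ v, 0 < f v m) :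
    Continuous fun v => above m (f v) / f v m :=
  ((continuous_above m).comp hf).div ((continuous_apply m).comp hf) fun v => (h v).ne'

/-- As the weight above `m` tends to zero, the points there need not converge. The condition `ht`
keeps the time at least `1/2` for small ratios, where `pulledTop` is simply the point at `m`. This
is why a pull has to be finished at time `1/2` rather than `1`. -/
theorem continuous_pulledTop (hup : ∀ p, m < p → p ∈ S) (hmS : m ∉ S) {f : Y → Join D.obj}
    (hf : Continuous f) (hS : ∀ v, f v ∈ D.colim A S) {t : Y → ℝ}
    (htc : Continuous fun v : {v // 0 < (f v).weight m} => t v)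
    (ht : ∀ v, 0 < (f v).weight m → above m (f v).weight / (f v).weight m ≤ 1 / 2 → 1 / 2 ≤ t v) :
    Continuous fun v : {v // 0 < (f v).weight m} => pulledTop m (t v) (f v) v.2 := by
  have hfv : Continuous fun v : {v // 0 < (f v).weight m} => f v.1 := hf.comp continuous_subtype_val
  refine continuous_of_locally fun v => ?_
  by_cases h : 0 < above m (f v).weight
  · obtain ⟨p, hp, hp'⟩ := exists_of_above_pos h
    refine ⟨{v | 0 < (f v).weight p}, (Join.isOpen_weight_pos p).preimage hfv, hp', ?_⟩
    have : Continuous fun v : {v : {v // 0 < (f v).weight m} | 0 < (f v).weight p} =>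
        D.pull m (t v) (D.map hp.le ((f v).point p v.2)) :=
      (D.continuous_pull m).comp ((htc.comp continuous_subtype_val).prodMk
        ((D.continuous_map hp.le).comp
          (Join.continuous_point_comp (hfv.comp continuous_subtype_val) p fun v => v.2)))
    convert this using 2 with v
    exact pulledTop_of_pos hup (hS v.1) v.1.2 hp v.2
  · have h0 : above m (f v).weight = 0 :=
      le_antisymm (not_lt.1 h) (above_nonneg (f v).weight_nonneg)
    refine ⟨{v | above m (f v).weight / (f v).weight m < 1 / 2}, isOpen_lt
      (continuous_ratio (f := fun v : {v // 0 < (f v).weight m} => (f v).weight)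
        (continuous_weight_comp hfv) fun v => v.2) continuous_const, ?_, ?_⟩
    · simp only [Set.mem_ofPred_eq, h0]
      norm_num
    · have : Continuous fun v : {v : {v // 0 < (f v).weight m} |
          above m (f v).weight / (f v).weight m < 1 / 2} => (f v).point m v.1.2 :=
        Join.continuous_point_comp (hfv.comp continuous_subtype_val) m _
      convert this using 2 with v
      exact pulledTop_eq_point hup hmS (hS v.1) (ht v.1 v.1.2 v.2.le) v.1.2

end ContractingDiagram

/-! ### Making the maps into one more object constant -/

namespace ContractingDiagram

variable {P : Type v} [PartialOrder P] [Fintype P] {D : ContractingDiagram.{u} P}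
variable {A S : Set P} {m : P}

theorem pull_mem_colim (hlow : ∀ q < m, q ∉ S) {S' : Set P}
    (hS' : S' = S ∨ S' = insert m S) {z : Join D.obj} (hz : z ∈ D.colim A (insert m S)) {w : P → ℝ}
    (hw : w ∈ stdSimplex ℝ P) (hs : ∀ p, 0 < w p → 0 < z.weight p) {t : ℝ}
    (ht : ∀ p, m < p → 0 < w p → 0 < w m →
      (m ∈ S' → t = 0) ∧ (m ∉ S' → t = 1)) :
    z.modify m w hw hs (fun hm => D.pull m t (z.point m hm)) ∈ D.colim A S' := by
  refine modify_mem_colim (S := insert m S) (fun p hp => ?_) (fun q hq => ?_) hz hw hs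
    fun p h hp hm => ?_
  · rcases hS' with rfl | rfl <;> simp [hp]
  · simp [hq.ne, hlow q hq]
  · rw [(hz.2.2 p m h (hs p hp) (hs m hm)).1 (Set.mem_insert _ _)]
    refine ⟨fun h' => ?_, fun h' => ?_⟩
    · rw [(ht p h hp hm).1 h', D.pull_zero]
    · rw [(ht p h hp hm).2 h']

theorem pulledTop_mem_colim (hup : ∀ p, m < p → p ∈ S) (hlow : ∀ q < m, q ∉ S) {S' : Set P}
    (hS' : S' = S ∨ S' = insert m S) {z : Join D.obj} (hz : z ∈ D.colim A S) {w : P → ℝ}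
    (hw : w ∈ stdSimplex ℝ P) (hs : ∀ p, 0 < w p → 0 < z.weight p) {t : ℝ}
    (ht : ∀ p, m < p → 0 < w p → 0 < w m →
      (m ∈ S' → t = 0) ∧ (m ∉ S' → 1 / 2 ≤ t)) :
    z.modify m w hw hs (fun hm => pulledTop m t z hm) ∈ D.colim A S' := by
  refine modify_mem_colim (S := S) (fun p hp => ?_) hlow hz hw hs fun p h hp hm => ?_
  · rcases hS' with rfl | rfl <;> simp [hp]
  · rw [pulledTop_of_pos hup hz (hs m hm) h (hs p hp)]
    refine ⟨fun h' => ?_, fun h' => ?_⟩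
    · rw [(ht p h hp hm).1 h', D.pull_zero]
    · exact D.pull_map h h _ _ ((ht p h hp hm).2 h') (by norm_num)

/-- The total weight above `m` relative to the weight of `m`. -/
def ratio (m : P) (w : P → ℝ) : ℝ := above m w / w m

theorem ratio_nonneg {w : P → ℝ} (hw : w ∈ stdSimplex ℝ P) : 0 ≤ ratio m w :=
  div_nonneg (above_nonneg hw.1) (hw.1 m)

theorem one_lt_ratio {w : P → ℝ} (hw : w ∈ stdSimplex ℝ P) {p : P} (hp : m < p)
    (h : 0 < shift m w p) (hm : 0 < shift m w m) : 1 < ratio m w :=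
  one_lt_ratio_of_shift_pos hw.1 (pos_of_shift_pos hw.1 hm) hp h

theorem ratio_shift_eq_zero_or {w : P → ℝ} (hw : w ∈ stdSimplex ℝ P) (hm : 0 < w m) :
    ratio m (shift m w) = 0 ∨ 1 < ratio m w := by
  rcases (above_nonneg (m := m) (shift_mem (m := m) hw).1).eq_or_lt with h | h
  · exact Or.inl (by rw [ratio, ← h, zero_div])
  · exact Or.inr (one_lt_ratio_of_above_shift_pos hw.1 hm h)

/-- Replace the inclusions into `D m` by constant maps. -/
def collapse (hlow : ∀ q < m, q ∉ S) (hmS : m ∉ S) :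
    C(D.colim A (insert m S), D.colim A S) where
  -- The pull time is `0` when nothing lies above `m`, and it is `1` wherever `m` and something
  -- above it survive the shift, as the constant relation requires.
  toFun z := ⟨_, pull_mem_colim hlow (S' := S) (Or.inl rfl) z.2 (shift_mem z.1.weight_mem)
    (fun _ => pos_of_shift_pos z.1.weight_nonneg) (t := clip (ratio m z.1.weight))
    fun p hp h hm => ⟨fun h' => absurd h' hmS, fun _ =>
      clip_of_one_le (one_lt_ratio z.1.weight_mem hp h hm).le⟩⟩
  continuous_toFun := by
    refine Continuous.subtype_mk (Join.continuous_modify continuous_subtype_val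
      ((continuous_shift m).comp (continuous_weight_comp continuous_subtype_val)) ?_) _
    refine (D.continuous_pull m).comp (Continuous.prodMk ?_ ?_)
    · exact continuous_clip.comp (continuous_ratio (continuous_weight_comp
        (continuous_subtype_val.comp continuous_subtype_val)) fun v => v.2)
    · exact Join.continuous_point_comp
        (continuous_subtype_val.comp continuous_subtype_val) m fun v => v.2

/-- Replace the constant maps into `D m` by inclusions. -/
def expand (hup : ∀ p, m < p → p ∈ S) (hlow : ∀ q < m, q ∉ S) (hmS : m ∉ S) :
    C(D.colim A S, D.colim A (insert m S)) where
  -- The time runs the other way: beyond ratio `1` it is `0` and gives the true image from above,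
  -- while up to ratio `1/2` it reproduces the point at `m`.
  toFun z := ⟨_, pulledTop_mem_colim hup hlow (S' := insert m S) (Or.inr rfl) z.2
    (shift_mem z.1.weight_mem) (fun _ => pos_of_shift_pos z.1.weight_nonneg)
    (t := clip (1 - ratio m z.1.weight))
    fun p hp h hm => ⟨fun _ => clip_of_nonpos (by linarith [one_lt_ratio z.1.weight_mem hp h hm]),
      fun h' => absurd (Set.mem_insert _ _) h'⟩⟩
  continuous_toFun := by
    refine Continuous.subtype_mk (Join.continuous_modify continuous_subtype_val
      ((continuous_shift m).comp (continuous_weight_comp continuous_subtype_val)) ?_) _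
    refine continuous_pulledTop hup hmS continuous_subtype_val (fun v => v.2)
      (t := fun v : D.colim A S => clip (1 - ratio m v.1.weight)) ?_ fun v hv h => ?_
    · exact continuous_clip.comp (continuous_const.sub (continuous_ratio (continuous_weight_comp
        (continuous_subtype_val.comp continuous_subtype_val)) fun v => v.2))
    · rw [clip_of_mem]
      · unfold ratio; linarith
      · unfold ratio; linarith
      · linarith [ratio_nonneg (m := m) v.1.weight_mem]

section Points

variable (hup : ∀ p, m < p → p ∈ S) (hlow : ∀ q < m, q ∉ S) (hmS : m ∉ S)

theorem collapse_point_self (z : D.colim A (insert m S))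
    (h : 0 < (collapse hlow hmS z).1.weight m) (hm : 0 < z.1.weight m) :
    (collapse hlow hmS z).1.point m h =
      D.pull m (clip (ratio m z.1.weight)) (z.1.point m hm) := by
  exact Join.modify_point_self (z := z.1) (w := shift m z.1.weight)
    (y := fun hm => D.pull m (clip (ratio m z.1.weight)) (z.1.point m hm)) h

theorem collapse_point_of_ne (z : D.colim A (insert m S)) {p : P} (hp : m ≠ p)
    (h : 0 < (collapse hlow hmS z).1.weight p) (h' : 0 < z.1.weight p) :
    (collapse hlow hmS z).1.point p h = z.1.point p h' := by
  exact Join.modify_point_of_ne (z := z.1) (w := shift m z.1.weight)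
    (y := fun hm => D.pull m (clip (ratio m z.1.weight)) (z.1.point m hm)) hp h

theorem expand_point_self (z : D.colim A S)
    (h : 0 < (expand hup hlow hmS z).1.weight m) (hm : 0 < z.1.weight m) :
    (expand hup hlow hmS z).1.point m h = pulledTop m (clip (1 - ratio m z.1.weight)) z.1 hm := by
  unfold expand at h ⊢
  exact Join.modify_point_self h

theorem expand_point_of_ne (z : D.colim A S) {p : P} (hp : m ≠ p)
    (h : 0 < (expand hup hlow hmS z).1.weight p) (h' : 0 < z.1.weight p) :
    (expand hup hlow hmS z).1.point p h = z.1.point p h' := by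
  unfold expand at h ⊢
  exact Join.modify_point_of_ne hp h

end Points

/-- The interpolation between the result of shifting weights twice and the original weights. -/
def unshift (m : P) (s : ℝ) (w : P → ℝ) : P → ℝ :=
  (1 - clip (2 * s - 1)) • shift m (shift m w) + clip (2 * s - 1) • w

theorem continuous_unshift {Y : Type*} [TopologicalSpace Y] {s : Y → ℝ} (hs : Continuous s)
    {w : Y → P → ℝ} (hw : Continuous w) : Continuous fun v => unshift m (s v) (w v) := by
  have h1 := continuous_clip
  have h2 := continuous_shift m
  unfold unshift
  fun_prop

theorem unshift_mem {w : P → ℝ} (hw : w ∈ stdSimplex ℝ P) (s : ℝ) :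
    unshift m s w ∈ stdSimplex ℝ P :=
  convex_stdSimplex ℝ P (shift_mem (shift_mem hw)) hw (sub_nonneg.2 (clip_le_one _))
    (clip_nonneg _) (by ring)

theorem pos_of_unshift_pos {w : P → ℝ} (hw : w ∈ stdSimplex ℝ P) {s : ℝ} (p : P)
    (h : 0 < unshift m s w p) : 0 < w p := by
  refine (hw.1 p).lt_of_ne' fun e => ?_
  have h' : shift m (shift m w) p = 0 := by
    refine le_antisymm (not_lt.1 fun h'' => ?_) ((shift_mem (shift_mem hw)).1 p)
    exact (pos_of_shift_pos hw.1 (pos_of_shift_pos (shift_mem hw).1 h'')).ne' e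
  simp [unshift, h', e] at h

theorem unshift_zero (w : P → ℝ) : unshift m 0 w = shift m (shift m w) := by
  simp [unshift, clip_of_nonpos]

theorem unshift_one (w : P → ℝ) : unshift m 1 w = w := by
  rw [unshift, clip_of_one_le (by norm_num), sub_self, zero_smul, one_smul, zero_add]

/-- The weights stay doubly shifted until time `1/2`, so up to then a surviving element above `m`
forces a large ratio; after that, the homotopies below have already corrected the point at `m`. -/
theorem one_lt_ratio_shift_or {w : P → ℝ} (hw : w ∈ stdSimplex ℝ P) {s : ℝ} {p : P} (hp : m < p)
    (h : 0 < unshift m s w p) (hm : 0 < unshift m s w m) :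
    clip (2 * s) = 1 ∨ 1 < ratio m (shift m w) := by
  by_cases hs : 1 ≤ 2 * s
  · exact Or.inl (clip_of_one_le hs)
  · right
    have h0 : clip (2 * s - 1) = 0 := clip_of_nonpos (by linarith)
    have h1 : unshift m s w = shift m (shift m w) := by simp [unshift, h0]
    rw [h1] at h hm
    exact one_lt_ratio (shift_mem hw) hp h hm

/-- The composite pulls the point at `m` by the minimum of the two times: if weight remains above
`m` after one shift, the first time is `1` and `expand` starts afresh from the unpulled image;
otherwise the second time is `1`. The homotopy runs this pull back to `0` and then restores the
weights. -/
theorem expand_comp_collapse (hup : ∀ p, m < p → p ∈ S) (hlow : ∀ q < m, q ∉ S) (hmS : m ∉ S) :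
    ((expand hup hlow hmS).comp (collapse (D := D) (A := A) hlow hmS)).Homotopic
      (ContinuousMap.id _) := by
  have hpos : ∀ w ∈ stdSimplex ℝ P, 1 < ratio m w → clip (1 - ratio m w) = 0 := fun w _ h =>
    clip_of_nonpos (by linarith)
  refine homotopic_of_continuous (fun q => ⟨_, pull_mem_colim hlow (S' := insert m S)
    (Or.inr rfl) q.2.2 (unshift_mem (m := m) q.2.1.weight_mem q.1)
    (pos_of_unshift_pos q.2.1.weight_mem)
    (t := (1 - clip (2 * q.1)) * min (clip (ratio m q.2.1.weight))
      (clip (1 - ratio m (shift m q.2.1.weight))))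
    fun p hp h hm => ⟨fun _ => ?_, fun h' => absurd (Set.mem_insert _ _) h'⟩⟩) ?_ ?_ ?_
  · rcases one_lt_ratio_shift_or q.2.1.weight_mem hp h hm with h' | h'
    · rw [h']; ring
    · rw [hpos _ (shift_mem q.2.1.weight_mem) h', min_eq_right (clip_nonneg _), mul_zero]
  · refine Continuous.subtype_mk (Join.continuous_modify
      (continuous_subtype_val.comp continuous_snd) (continuous_unshift continuous_fst
        (continuous_weight_comp (continuous_subtype_val.comp continuous_snd))) ?_) _
    have h0 : Continuous fun v : {v : ℝ × D.colim A (insert m S) // 0 < v.2.1.weight m} =>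
      v.1.2.1 := by fun_prop
    have h1 := continuous_weight_comp h0
    refine (D.continuous_pull m).comp (Continuous.prodMk (Continuous.mul ?_ ?_)
      (Join.continuous_point_comp h0 m fun v => v.2))
    · have := continuous_clip
      fun_prop
    · refine Continuous.min (continuous_clip.comp (continuous_ratio h1 fun v => v.2))
        (continuous_clip.comp (continuous_const.sub (continuous_ratio
          ((continuous_shift m).comp h1) fun v => ?_)))
      exact shift_self_pos v.1.2.1.weight_nonneg v.2
  · intro z
    refine Subtype.ext (Join.ext' (fun p => ?_) fun p h h' => ?_)
    · exact congrFun (unshift_zero _) p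
    · by_cases e : m = p
      · subst e
        have hm : 0 < z.1.weight m := pos_of_unshift_pos z.1.weight_mem m h
        rw [Join.modify_point_self]
        refine Eq.trans ?_ (expand_point_self hup hlow hmS _ h'
          (shift_self_pos z.1.weight_nonneg hm)).symm
        have hc : clip (2 * 0) = 0 := clip_of_nonpos (by norm_num)
        rw [hc, sub_zero, one_mul]
        by_cases ha : 0 < above m (shift m z.1.weight)
        · obtain ⟨p, hp, hp'⟩ := exists_of_above_pos ha
          have h1 := one_lt_ratio_of_above_shift_pos z.1.weight_nonneg hm ha
          have hzp := pos_of_shift_pos z.1.weight_nonneg hp'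
          refine Eq.trans ?_ (pulledTop_of_pos hup (collapse hlow hmS z).2
            (shift_self_pos z.1.weight_nonneg hm) hp hp').symm
          rw [show clip (ratio m z.1.weight) = 1 from clip_of_one_le h1.le,
            min_eq_right (clip_le_one _)]
          congr 1
          rw [(z.2.2.2 p m hp hzp hm).1 (Set.mem_insert _ _)]
          exact congrArg _ (collapse_point_of_ne hlow hmS z hp.ne hp' hzp).symm
        · refine Eq.trans ?_ (dif_neg ha).symm
          have h0 : ratio m (shift m z.1.weight) = 0 := by
            rw [ratio, le_antisymm (not_lt.1 ha) (above_nonneg (shift_mem z.1.weight_mem).1),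
              zero_div]
          rw [h0, sub_zero, show clip 1 = 1 from clip_of_one_le le_rfl,
            min_eq_left (clip_le_one _)]
          exact (collapse_point_self hlow hmS z _ hm).symm
      · rw [Join.modify_point_of_ne e]
        exact ((expand_point_of_ne hup hlow hmS _ e h' (pos_of_shift_pos
          (shift_mem z.1.weight_mem).1 h')).trans (collapse_point_of_ne hlow hmS z e _ _)).symm
  · intro z
    refine Subtype.ext (Join.ext' (fun p => ?_) fun p h h' => ?_)
    · exact congrFun (unshift_one _) p
    · by_cases e : m = p
      · subst e
        rw [Join.modify_point_self]
        have hc : clip (2 * 1) = 1 := clip_of_one_le (by norm_num)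
        rw [hc, sub_self, zero_mul, D.pull_zero]
        rfl
      · rw [Join.modify_point_of_ne e]
        rfl

/-- Here the times combine to a maximum: either the ratio after one shift is `0` and `collapse` does
not pull, or the original ratio exceeds `1` and `expand` does not pull. The homotopy raises the time
to `1`, where `pulledTop` is the original point, and then restores the weights. -/
theorem collapse_comp_expand (hup : ∀ p, m < p → p ∈ S) (hlow : ∀ q < m, q ∉ S) (hmS : m ∉ S) :
    ((collapse hlow hmS).comp (expand (D := D) (A := A) hup hlow hmS)).Homotopic
      (ContinuousMap.id _) := by
  refine homotopic_of_continuous (fun q => ⟨_, pulledTop_mem_colim hup hlow (S' := S)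
    (Or.inl rfl) q.2.2 (unshift_mem (m := m) q.2.1.weight_mem q.1)
    (pos_of_unshift_pos q.2.1.weight_mem)
    (t := max (max (clip (ratio m (shift m q.2.1.weight)))
      (clip (1 - ratio m q.2.1.weight))) (clip (2 * q.1)))
    fun p hp h hm => ⟨fun h' => absurd h' hmS, fun _ => ?_⟩⟩) ?_ ?_ ?_
  · rcases one_lt_ratio_shift_or q.2.1.weight_mem hp h hm with h' | h'
    · exact le_max_of_le_right (by rw [h']; norm_num)
    · refine le_max_of_le_left (le_max_of_le_left ?_)
      rw [clip_of_one_le h'.le]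
      norm_num
  · refine Continuous.subtype_mk (Join.continuous_modify
      (continuous_subtype_val.comp continuous_snd) (continuous_unshift continuous_fst
        (continuous_weight_comp (continuous_subtype_val.comp continuous_snd))) ?_) _
    have h0 : Continuous fun v : {v : ℝ × D.colim A S // 0 < v.2.1.weight m} =>
      v.1.2.1 := by fun_prop
    have h1 := continuous_weight_comp h0
    refine continuous_pulledTop hup hmS (continuous_subtype_val.comp continuous_snd)
      (fun v => v.2.2) (t := fun q : ℝ × D.colim A S =>
        max (max (clip (ratio m (shift m q.2.1.weight)))
          (clip (1 - ratio m q.2.1.weight))) (clip (2 * q.1))) ?_ fun v hv h => ?_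
    · refine Continuous.max (Continuous.max ?_ ?_) ?_
      · exact continuous_clip.comp (continuous_ratio ((continuous_shift m).comp h1) fun v =>
          shift_self_pos v.1.2.1.weight_nonneg v.2)
      · exact continuous_clip.comp (continuous_const.sub (continuous_ratio h1 fun v => v.2))
      · have := continuous_clip
        fun_prop
    · refine le_max_of_le_left (le_max_of_le_right ?_)
      simp only [Function.comp_apply] at h
      rw [clip_of_mem]
      · unfold ratio; linarith
      · unfold ratio; linarith
      · linarith [ratio_nonneg (m := m) v.2.1.weight_mem]
  · intro z
    refine Subtype.ext (Join.ext' (fun p => ?_) fun p h h' => ?_)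
    · exact congrFun (unshift_zero _) p
    · by_cases e : m = p
      · subst e
        have hm : 0 < z.1.weight m := pos_of_unshift_pos z.1.weight_mem m h
        rw [Join.modify_point_self]
        refine Eq.trans ?_ (collapse_point_self hlow hmS _ h'
          (shift_self_pos z.1.weight_nonneg hm)).symm
        have hc : clip (2 * 0) = 0 := clip_of_nonpos (by norm_num)
        rw [hc, max_eq_left (le_max_of_le_left (clip_nonneg _))]
        refine Eq.trans ?_ (congrArg _ (expand_point_self hup hlow hmS z _ hm).symm)
        show _ = D.pull m (clip (ratio m (shift m z.1.weight))) _
        rcases ratio_shift_eq_zero_or z.1.weight_mem hm with h0 | h1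
        · rw [h0, show clip 0 = 0 from clip_of_nonpos le_rfl, max_eq_right (clip_nonneg _),
            D.pull_zero]
        · rw [show clip (1 - ratio m z.1.weight) = 0 from clip_of_nonpos (by linarith),
            max_eq_left (clip_nonneg _)]
          have ha : 0 < above m z.1.weight := by
            by_contra ha
            rw [ratio, le_antisymm (not_lt.1 ha) (above_nonneg z.1.weight_nonneg), zero_div] at h1
            exact absurd h1 (by norm_num)
          rw [pulledTop, dif_pos ha, pulledTop, dif_pos ha, D.pull_zero]
      · rw [Join.modify_point_of_ne e]
        exact ((collapse_point_of_ne hlow hmS _ e h' (pos_of_shift_pos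
          (shift_mem z.1.weight_mem).1 h')).trans (expand_point_of_ne hup hlow hmS z e _ _)).symm
  · intro z
    refine Subtype.ext (Join.ext' (fun p => ?_) fun p h h' => ?_)
    · exact congrFun (unshift_one _) p
    · by_cases e : m = p
      · subst e
        rw [Join.modify_point_self]
        refine pulledTop_eq_point hup hmS z.2 ?_ _
        refine le_max_of_le_right ?_
        rw [clip_of_one_le (by norm_num)]
        norm_num
      · rw [Join.modify_point_of_ne e]
        rfl

variable (D A)

theorem nonempty_homotopyEquiv_insert (hup : ∀ p, m < p → p ∈ S) (hlow : ∀ q < m, q ∉ S)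
    (hmS : m ∉ S) :
    Nonempty (ContinuousMap.HomotopyEquiv (D.colim A (insert m S)) (D.colim A S)) :=
  ⟨⟨collapse hlow hmS, expand hup hlow hmS, expand_comp_collapse hup hlow hmS,
    collapse_comp_expand hup hlow hmS⟩⟩

/-- A maximal element `m` of the complement has everything above it in `S` and nothing below it in
`S`, which is the setting of the one-step equivalence. Read from `Set.univ` down to `S`, constant
maps are introduced from the bottom up. -/
theorem nonempty_homotopyEquiv_of_isUpperSet {S : Set P} (hS : IsUpperSet S) :
    Nonempty (ContinuousMap.HomotopyEquiv (D.colim A Set.univ) (D.colim A S)) := by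
  induction hn : Sᶜ.ncard generalizing S with
  | zero =>
    rw [Set.ncard_eq_zero, Set.compl_empty_iff] at hn
    subst hn
    exact ⟨ContinuousMap.HomotopyEquiv.refl _⟩
  | succ n ih =>
    have hne : Sᶜ.Nonempty := (Set.ncard_pos).1 (by omega)
    obtain ⟨m, hm⟩ := (Set.toFinite Sᶜ).exists_maximal hne
    have hup : ∀ p, m < p → p ∈ S := fun p hp => by
      by_contra h
      exact hp.not_ge (hm.2 h hp.le)
    have hlow : ∀ q < m, q ∉ S := fun q hq h => hm.1 (hS hq.le h)
    have hS' : IsUpperSet (insert m S) := by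
      rintro a b hab (rfl | ha)
      · rcases hab.eq_or_lt with rfl | h
        exacts [Set.mem_insert _ _, Or.inr (hup b h)]
      · exact Or.inr (hS hab ha)
    obtain ⟨e⟩ := ih hS' (by
      have : (insert m S)ᶜ = Sᶜ \ {m} := by
        ext x
        simp [and_comm]
      rw [this, Set.ncard_sdiff_singleton_of_mem hm.1, hn]
      rfl)
    obtain ⟨e'⟩ := nonempty_homotopyEquiv_insert D A hup hlow hm.1
    exact ⟨e.trans e'⟩

end ContractingDiagram

/-! ### Diagrams of iterated joins given by strictly antitone maps -/

namespace SubJoin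

variable {X : Type u} {ι : Type v} [Fintype ι] {ι' : Type w} {B C : Set ι}
  {B' : Set ι'}

open Classical in
/-- The weights of `relabel`. -/
def relabelWeight (e : B ≃ B') (x : SubJoin X B) (i : ι') : ℝ :=
  if h : i ∈ B' then x.weight (e.symm ⟨i, h⟩) else 0

theorem mem_of_relabelWeight_pos {e : B ≃ B'} {x : SubJoin X B} {i : ι'}
    (h : 0 < relabelWeight e x i) : i ∈ B' := by
  by_contra h'
  rw [relabelWeight, dif_neg h'] at h
  exact h.false

variable [Fintype ι']

theorem sum_relabelWeight (e : B ≃ B') (x : SubJoin X B) : ∑ i, relabelWeight e x i = 1 := by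
  classical
  rw [← x.sum_weight, ← Finset.sum_filter_add_sum_filter_not _ (· ∈ B') (relabelWeight e x),
    ← Finset.sum_filter_add_sum_filter_not _ (· ∈ B) x.weight]
  congr 1
  · rw [← Finset.sum_subtype_eq_sum_filter, ← Finset.sum_subtype_eq_sum_filter,
      Finset.subtype_univ, Finset.subtype_univ]
    refine Fintype.sum_equiv e.symm _ _ fun i => ?_
    exact dif_pos i.2
  · rw [Finset.sum_eq_zero, Finset.sum_eq_zero]
    · intro i hi
      exact le_antisymm (not_lt.1 fun h => (Finset.mem_filter.1 hi).2 (mem_of_pos x h))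
        (x.weight_nonneg i)
    · intro i hi
      exact dif_neg (Finset.mem_filter.1 hi).2

/-- Relabelling the factors of an iterated join. -/
def relabel (e : B ≃ B') (x : SubJoin X B) : SubJoin X B' where
  weight := relabelWeight e x
  weight_mem := ⟨fun i => by
    unfold relabelWeight
    split_ifs
    exacts [x.weight_nonneg _, le_rfl], sum_relabelWeight e x⟩
  point i h := ⟨(x.point (e.symm ⟨i, mem_of_relabelWeight_pos h⟩)
    (by rwa [relabelWeight, dif_pos (mem_of_relabelWeight_pos h)] at h)).1,
    mem_of_relabelWeight_pos h⟩

theorem relabel_weight (e : B ≃ B') (x : SubJoin X B) {i : ι'} (h : i ∈ B') :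
    (relabel e x).weight i = x.weight (e.symm ⟨i, h⟩) := dif_pos h

theorem weight_eq_zero (x : SubJoin X B) {i : ι} (h : i ∉ B) : x.weight i = 0 :=
  le_antisymm (not_lt.1 fun h' => h (mem_of_pos x h')) (x.weight_nonneg i)

theorem point_congr (x : SubJoin X B) {i j : ι} (e : i = j) (h : 0 < x.weight i)
    (h' : 0 < x.weight j) : (x.point i h).1 = (x.point j h').1 := by
  subst e
  rfl

theorem relabel_symm_relabel (e : B ≃ B') (x : SubJoin X B) :
    relabel e.symm (relabel e x) = x := by
  refine Join.ext' (fun i => ?_) fun i h h' => ?_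
  · by_cases hi : i ∈ B
    · rw [relabel_weight _ _ hi, relabel_weight _ _ (Subtype.coe_prop _)]
      simp
    · rw [weight_eq_zero _ hi, weight_eq_zero _ hi]
  · have hi : ((e.symm (e.symm.symm ⟨i, mem_of_pos x h'⟩) : B) : ι) = i := by simp
    exact Subtype.ext (point_congr x hi (by rw [hi]; exact h') h')

theorem relabel_vertex (e : B ≃ B') (x₀ : X) {i₀ : ι} (hi₀ : i₀ ∈ B) {i₁ : ι'} (hi₁ : i₁ ∈ B')
    (h : e ⟨i₀, hi₀⟩ = ⟨i₁, hi₁⟩) : relabel e (vertex hi₀ x₀) = vertex hi₁ x₀ := by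
  classical
  refine Join.ext' (fun i => ?_) fun i _ _ => Subtype.ext rfl
  by_cases hi : i ∈ B'
  · rw [relabel_weight _ _ hi]
    simp only [vertex, Pi.single_apply]
    refine if_congr ?_ rfl rfl
    constructor
    · intro h'
      have : e.symm ⟨i, hi⟩ = ⟨i₀, hi₀⟩ := Subtype.ext h'
      rw [Equiv.symm_apply_eq, h] at this
      exact congrArg Subtype.val this
    · rintro rfl
      rw [← h, Equiv.symm_apply_apply]
  · rw [weight_eq_zero _ hi, weight_eq_zero _ hi]

/-- The inclusion of the join over a smaller index set. -/
def incl (h : B ⊆ C) (x : SubJoin X B) : SubJoin X C := Join.map (fun _ y => ⟨y.1, h y.2⟩) x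

/-- The inclusion into the join over all indices. -/
def forget (x : SubJoin X B) : Join (fun _ : ι => X) := Join.map (fun _ y => y.1) x

/-- The point of `SubJoin X B` given by a point of the whole join. -/
def restrict (x : Join (fun _ : ι => X)) (h : ∀ i, 0 < x.weight i → i ∈ B) : SubJoin X B where
  weight := x.weight
  weight_mem := x.weight_mem
  point i hi := ⟨x.point i hi, h i hi⟩

variable [TopologicalSpace X]

theorem continuous_relabel (e : B ≃ B') : Continuous (relabel (X := X) e) := by
  refine Join.continuous_of (fun i => ?_) fun i => ?_
  · show Continuous fun x => relabelWeight e x i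
    unfold relabelWeight
    split_ifs
    exacts [Join.continuous_weight _, continuous_const]
  · refine continuous_induced_rng.2 ?_
    by_cases hi : i ∈ B'
    · exact (continuous_subtype_val.comp (Join.continuous_point_comp
        (f := fun x : {x : SubJoin X B // 0 < relabelWeight e x i} => x.1) continuous_subtype_val
        (e.symm ⟨i, hi⟩).1 fun x => by
          have := x.2
          rwa [relabelWeight, dif_pos hi] at this) :)
    · exact continuous_of_locally fun x => absurd (mem_of_relabelWeight_pos x.2) hi

/-- Relabelling the factors of an iterated join, as a homeomorphism. -/
def relabelHomeomorph (e : B ≃ B') : SubJoin X B ≃ₜ SubJoin X B' where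
  toFun := relabel e
  invFun := relabel e.symm
  left_inv := relabel_symm_relabel e
  right_inv := relabel_symm_relabel e.symm
  continuous_toFun := continuous_relabel e
  continuous_invFun := continuous_relabel e.symm

theorem continuous_incl (h : B ⊆ C) : Continuous (incl (X := X) h) :=
  Join.continuous_map (f := fun i (y : {_x : X // i ∈ B}) => (⟨y.1, h y.2⟩ : {_x : X // i ∈ C}))
    fun _ => continuous_subtype_val.subtype_mk _

theorem continuous_forget : Continuous (forget : SubJoin X B → _) :=
  Join.continuous_map fun _ => continuous_subtype_val

theorem continuous_restrict {Y : Type*} [TopologicalSpace Y] {f : Y → Join (fun _ : ι => X)}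
    (hf : Continuous f) (h : ∀ y i, 0 < (f y).weight i → i ∈ B) :
    Continuous fun y => restrict (f y) (h y) := by
  refine Join.continuous_of (fun i => ?_) fun i => ?_
  · exact ((Join.continuous_weight (Z := fun _ : ι => X) i).comp hf :)
  · exact (Join.continuous_point_comp (f := fun y : {y // 0 < (f y).weight i} => f y.1)
      (hf.comp continuous_subtype_val) i fun y => y.2).subtype_mk fun y => h y.1 i y.2

end SubJoin

/-! ### Dependence on the cardinalities of the index sets only -/

section SubJoinDiagram

variable {P : Type v} [PartialOrder P] {ι : Type w} [Fintype ι]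
  (X : Type u) [TopologicalSpace X]

variable {X}

open Classical in
/-- The diagram of the spaces `SubJoin X (l p)`, for `l` strictly antitone, with the contractions
of the boundaries to the vertices given by `b`. -/
def subJoinDiagram (x₀ : X) {l : P → Set ι} (hl : StrictAnti l)
    (b : ∀ p, (l p).Nonempty → l p) : ContractingDiagram P where
  obj p := SubJoin X (l p)
  map h := SubJoin.incl (hl.antitone h)
  continuous_map h := SubJoin.continuous_incl _
  map_map _ _ _ := rfl
  pull p t x := if h : (l p).Nonempty then SubJoin.contract (b p h).2 x₀ t x else x
  continuous_pull p := by
    split_ifs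
    exacts [SubJoin.continuous_contract _ x₀, continuous_snd]
  pull_zero p x := by
    split_ifs
    exacts [SubJoin.contract_zero _ x₀ x, rfl]
  pull_map {m p p'} h h' x x' t t' ht ht' := by
    -- Strictness yields an index of `l m` outside `l p`; its weight vanishes on the image of the
    -- space at `p`, which therefore lies in the boundary.
    obtain ⟨i, him, hip⟩ := Set.exists_of_ssubset (hl h)
    obtain ⟨i', him', hip'⟩ := Set.exists_of_ssubset (hl h')
    have hne : (l m).Nonempty := ⟨i, him⟩
    simp only [hne, dif_pos]
    rw [SubJoin.contract_of_weight_eq_zero _ x₀ ht him (SubJoin.weight_eq_zero x hip),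
      SubJoin.contract_of_weight_eq_zero _ x₀ ht' him' (SubJoin.weight_eq_zero x' hip')]

theorem subJoinDiagram_pull_map (x₀ : X) {l : P → Set ι} (hl : StrictAnti l)
    (b : ∀ p, (l p).Nonempty → l p) {q p : P} (h : q < p) (hne : (l q).Nonempty)
    (x : SubJoin X (l p)) :
    (subJoinDiagram x₀ hl b).pull q 1 ((subJoinDiagram x₀ hl b).map h.le x) =
      SubJoin.vertex (b q hne).2 x₀ := by
  obtain ⟨i, hiq, hip⟩ := Set.exists_of_ssubset (hl h)
  refine (dif_pos hne).trans ?_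
  exact SubJoin.contract_of_weight_eq_zero _ x₀ (by norm_num) hiq (SubJoin.weight_eq_zero x hip)

variable [Fintype P]

variable (X) in
/-- The homotopy colimit, over the elements of `A`, of the diagram of the joins `SubJoin X (l p)`,
as a space of pairs of points of the order complex and of the join over all indices. -/
def realization (A : Set P) (l : P → Set ι) : Set ((P → ℝ) × Join (fun _ : ι => X)) :=
  {y | y.1 ∈ stdSimplex ℝ P ∧ (∀ p, 0 < y.1 p → p ∈ A) ∧ IsChain (· ≤ ·) {p | 0 < y.1 p} ∧
    ∀ p i, 0 < y.1 p → 0 < y.2.weight i → i ∈ l p}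

section Univ

variable {x₀ : X} {l : P → Set ι} {hl : StrictAnti l} {b : ∀ p, (l p).Nonempty → l p} {A : Set P}

/-- The common underlying point of all points of an element of the homotopy colimit. -/
def underlying (z : Join (subJoinDiagram x₀ hl b).obj) : Join (fun _ : ι => X) :=
  SubJoin.forget (z.point z.exists_weight_pos.choose z.exists_weight_pos.choose_spec)

/-- When all maps are inclusions, the points along the chain agree in the join over all indices. -/
theorem underlying_eq {z : Join (subJoinDiagram x₀ hl b).obj}
    (hz : z ∈ (subJoinDiagram x₀ hl b).colim A Set.univ) {p : P} (hp : 0 < z.weight p) :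
    underlying z = SubJoin.forget (z.point p hp) := by
  unfold underlying
  have hq := z.exists_weight_pos.choose_spec
  generalize_proofs _ h1
  generalize z.exists_weight_pos.choose = q at *
  by_cases e : q = p
  · subst e
    rfl
  · rcases hz.2.1 h1 hp e with hle | hle
    · rw [(hz.2.2 p q (lt_of_le_of_ne hle e) hp h1).1 trivial]
      rfl
    · rw [(hz.2.2 q p (lt_of_le_of_ne hle (Ne.symm e)) h1 hp).1 trivial]
      rfl

variable (x₀ hl b A)

/-- The two models of the homotopy colimit of the diagram of the spaces `SubJoin X (l p)`. -/
def realizationHomeomorph :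
    realization X A l ≃ₜ (subJoinDiagram x₀ hl b).colim A Set.univ where
  toFun y := ⟨⟨y.1.1, y.2.1, fun p hp => SubJoin.restrict y.1.2 fun i => y.2.2.2.2 p i hp⟩,
    y.2.2.1, y.2.2.2.1, fun _ _ _ _ _ => ⟨fun _ => rfl, fun h => absurd trivial h⟩⟩
  invFun z := ⟨(z.1.weight, underlying z.1), z.1.weight_mem, z.2.1, z.2.2.1, fun p i hp hi => by
    rw [underlying_eq z.2 hp] at hi
    exact SubJoin.mem_of_pos (z.1.point p hp) hi⟩
  left_inv y := rfl
  right_inv z := by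
    refine Subtype.ext (Join.ext' (fun _ => rfl) fun p _ hp => ?_)
    refine Eq.trans (b := SubJoin.restrict (SubJoin.forget (z.1.point p hp))
      fun i => SubJoin.mem_of_pos (z.1.point p hp)) ?_ rfl
    simp only [underlying_eq z.2 hp]
  continuous_toFun := by
    refine Continuous.subtype_mk (Join.continuous_of (fun p => ?_) fun p => ?_) _
    · exact (continuous_apply p).comp (continuous_fst.comp continuous_subtype_val)
    · exact SubJoin.continuous_restrict
        (continuous_snd.comp (continuous_subtype_val.comp continuous_subtype_val)) _
  continuous_invFun := by
    refine Continuous.subtype_mk (Continuous.prodMk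
      (ContractingDiagram.continuous_weight_comp continuous_subtype_val) ?_) _
    refine continuous_of_locally fun z => ?_
    obtain ⟨p, hp⟩ := z.1.exists_weight_pos
    refine ⟨{z | 0 < z.1.weight p}, (Join.isOpen_weight_pos p).preimage continuous_subtype_val,
      hp, ?_⟩
    have : Continuous fun v : {z : (subJoinDiagram x₀ hl b).colim A Set.univ | 0 < z.1.weight p} =>
        SubJoin.forget (v.1.1.point p v.2) :=
      SubJoin.continuous_forget.comp (Join.continuous_point_comp
        (continuous_subtype_val.comp continuous_subtype_val) p fun v => v.2)
    convert this using 2 with v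
    exact underlying_eq v.1.2 v.2

end Univ

/-- Up to homotopy equivalence, the homotopy colimit of the diagram of the spaces `SubJoin X (l p)`,
for `l` strictly antitone, depends only on the cardinalities of the sets `l p`. -/
theorem nonempty_homotopyEquiv_realization {ι' : Type*} [Fintype ι'] (A : Set P)
    {l : P → Set ι} (hl : StrictAnti l) {l' : P → Set ι'} (hl' : StrictAnti l')
    (e : ∀ p, l p ≃ l' p) :
    Nonempty (ContinuousMap.HomotopyEquiv (realization X A l) (realization X A l')) := by
  rcases isEmpty_or_nonempty X with hX | ⟨⟨x₀⟩⟩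
  · have h1 : IsEmpty (realization X A l) :=
      ⟨fun y => hX.false (y.1.2.point _ y.1.2.exists_weight_pos.choose_spec)⟩
    have h2 : IsEmpty (realization X A l') :=
      ⟨fun y => hX.false (y.1.2.point _ y.1.2.exists_weight_pos.choose_spec)⟩
    exact nonempty_homotopyEquiv_of_isEmpty
  have hne : ∀ p, (l' p).Nonempty → (l p).Nonempty := fun p ⟨i, hi⟩ =>
    ⟨_, ((e p).symm ⟨i, hi⟩).2⟩
  have hne' : ∀ p, (l p).Nonempty → (l' p).Nonempty := fun p ⟨i, hi⟩ =>
    ⟨_, ((e p) ⟨i, hi⟩).2⟩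
  let b : ∀ p, (l p).Nonempty → l p := fun p h => ⟨h.some, h.some_mem⟩
  -- The base vertices are transported along `e`, so that relabelling respects them.
  let b' : ∀ p, (l' p).Nonempty → l' p := fun p h => e p (b p (hne p h))
  let D := subJoinDiagram x₀ hl b
  let D' := subJoinDiagram x₀ hl' b'
  obtain ⟨f⟩ := D.nonempty_homotopyEquiv_of_isUpperSet A isUpperSet_empty
  obtain ⟨f'⟩ := D'.nonempty_homotopyEquiv_of_isUpperSet A isUpperSet_empty
  let φ : Join D.obj ≃ₜ Join D'.obj := Join.homeomorph fun p => SubJoin.relabelHomeomorph (e p)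
  -- With all maps constant, the relations only say that each point below another one is the base
  -- vertex, so the bijections `e p` need not be compatible for different `p`.
  have hφ : D.colim A ∅ = φ ⁻¹' D'.colim A ∅ := by
    ext z
    refine and_congr_right fun _ => and_congr_right fun _ => ?_
    refine forall_congr' fun p => forall_congr' fun q => forall_congr' fun h =>
      forall_congr' fun hp => forall_congr' fun hq => ?_
    refine and_congr (by simp) (imp_congr_right fun _ => ?_)
    have hlq : (l q).Nonempty :=
      ⟨_, SubJoin.mem_of_pos (z.point q hq) (z.point q hq).exists_weight_pos.choose_spec⟩
    have h1 : D.pull q 1 (D.map h.le (z.point p hp)) = SubJoin.vertex (b q hlq).2 x₀ :=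
      subJoinDiagram_pull_map x₀ hl b h hlq _
    have h2 : D'.pull q 1 (D'.map h.le ((φ z).point p hp)) =
        SubJoin.relabel (e q) (SubJoin.vertex (b q hlq).2 x₀) :=
      (subJoinDiagram_pull_map x₀ hl' b' h (hne' q hlq) _).trans
        (SubJoin.relabel_vertex (e q) x₀ (b q hlq).2 (b' q (hne' q hlq)).2 rfl).symm
    exact (iff_of_eq (congrArg (z.point q hq = ·) h1)).trans
      ((SubJoin.relabelHomeomorph (e q)).injective.eq_iff.symm.trans
        (iff_of_eq (congrArg ((φ z).point q hq = ·) h2.symm)))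
  exact ⟨((realizationHomeomorph x₀ hl b A).toHomotopyEquiv.trans f).trans
    ((φ.sets hφ).toHomotopyEquiv.trans
      (f'.symm.trans (realizationHomeomorph x₀ hl' b' A).symm.toHomotopyEquiv))⟩

end SubJoinDiagram

/-! ### Homotopy colimits of suspended diagrams -/

/-! ### Products in which one factor is only partially defined -/

section Scaled

variable {Y : Type*} [TopologicalSpace Y]

open Classical in
/-- The product `k * φ`, where `φ` is defined only if `0 < k`. -/
def scaled (k : ℝ) (φ : 0 < k → ℝ) : ℝ := if h : 0 < k then k * φ h else 0

theorem scaled_of_pos {k : ℝ} {φ : 0 < k → ℝ} (h : 0 < k) : scaled k φ = k * φ h := dif_pos h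

theorem scaled_of_not {k : ℝ} {φ : 0 < k → ℝ} (h : ¬ 0 < k) : scaled k φ = 0 := dif_neg h

theorem scaled_nonneg {k : ℝ} {φ : 0 < k → ℝ} (hφ : ∀ h, 0 ≤ φ h) : 0 ≤ scaled k φ := by
  unfold scaled
  split_ifs with h
  exacts [mul_nonneg h.le (hφ h), le_rfl]

theorem pos_of_scaled_pos {k : ℝ} {φ : 0 < k → ℝ} (h : 0 < scaled k φ) :
    ∃ h' : 0 < k, 0 < φ h' := by
  unfold scaled at h
  split_ifs at h with h'
  exacts [⟨h', (pos_iff_pos_of_mul_pos h).1 h'⟩, absurd h (lt_irrefl _)]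

/-- Where `k` vanishes `φ` need not have a limit, but it lies between `0` and `1`, so the product is
squeezed to `0`. -/
theorem continuous_scaled {k : Y → ℝ} (hk : Continuous k) (hk0 : ∀ y, 0 ≤ k y)
    {φ : ∀ y, 0 < k y → ℝ} (h0 : ∀ y h, 0 ≤ φ y h) (h1 : ∀ y h, φ y h ≤ 1)
    (hφ : Continuous fun y : {y // 0 < k y} => φ y.1 y.2) :
    Continuous fun y => scaled (k y) (φ y) := by
  rw [continuous_iff_continuousAt]
  intro y
  by_cases h : 0 < k y
  · have : ContinuousOn (fun y => scaled (k y) (φ y)) {y | 0 < k y} := by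
      rw [continuousOn_iff_continuous_domRestrict]
      have : Continuous fun y : {y // 0 < k y} => k y.1 * φ y.1 y.2 :=
        (hk.comp continuous_subtype_val).mul hφ
      exact this.congr fun v => (scaled_of_pos v.2).symm
    exact this.continuousAt ((isOpen_lt continuous_const hk).mem_nhds h)
  · have hy : k y = 0 := le_antisymm (not_lt.1 h) (hk0 y)
    rw [ContinuousAt, scaled_of_not h]
    refine squeeze_zero (fun v => scaled_nonneg (h0 v)) (fun v => ?_) (hy ▸ hk.tendsto y)
    by_cases hv : 0 < k v
    · rw [scaled_of_pos hv]
      exact mul_le_of_le_one_right hv.le (h1 v hv)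
    · rw [scaled_of_not hv]
      exact hk0 v

end Scaled

/-! ### Joins of two spaces -/

section PairJoin

variable {A : Type u} {B : Type v} {s r : ℝ}

/-- The point `s a + r b` of the join of two spaces. -/
def pairJoin (hs : 0 ≤ s) (hr : 0 ≤ r) (h : s + r = 1) (a : 0 < s → A) (b : 0 < r → B) :
    BinaryJoin A B where
  weight c := cond c r s
  weight_mem := ⟨fun c => by cases c <;> assumption, by simpa [add_comm] using h⟩
  point
    | false => fun h => ULift.up (a h)
    | true => fun h => ULift.up (b h)

theorem BinaryJoin.weight_add_weight (z : BinaryJoin A B) : z.weight false + z.weight true = 1 := by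
  rw [← z.sum_weight, Fintype.sum_bool, add_comm]

/-- The point of the first space. -/
def BinaryJoin.left (z : BinaryJoin A B) (h : 0 < z.weight false) : A :=
  ULift.down (show ULift A from z.point false h)

/-- The point of the second space. -/
def BinaryJoin.right (z : BinaryJoin A B) (h : 0 < z.weight true) : B :=
  ULift.down (show ULift B from z.point true h)

theorem BinaryJoin.ext {z w : BinaryJoin A B} (h : z.weight false = w.weight false)
    (hl : ∀ h h', z.left h = w.left h') (hr : ∀ h h', z.right h = w.right h') : z = w := by
  refine Join.ext' (fun c => ?_) fun c h' h'' => ?_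
  · cases c
    · exact h
    · linarith [z.weight_add_weight, w.weight_add_weight]
  · cases c
    · exact ULift.ext _ _ (hl h' h'')
    · exact ULift.ext _ _ (hr h' h'')

variable [TopologicalSpace A] [TopologicalSpace B] {Y : Type*} [TopologicalSpace Y]

theorem continuous_pairJoin {s r : Y → ℝ} {hs : ∀ y, 0 ≤ s y} {hr : ∀ y, 0 ≤ r y}
    {h : ∀ y, s y + r y = 1} {a : ∀ y, 0 < s y → A} {b : ∀ y, 0 < r y → B}
    (hsc : Continuous s) (hrc : Continuous r) (ha : Continuous fun y : {y // 0 < s y} => a y.1 y.2)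
    (hb : Continuous fun y : {y // 0 < r y} => b y.1 y.2) :
    Continuous fun y => pairJoin (hs y) (hr y) (h y) (a y) (b y) := by
  refine Join.continuous_of (fun c => ?_) fun c => ?_
  · cases c
    exacts [hsc, hrc]
  · cases c
    exacts [continuous_uliftUp.comp ha, continuous_uliftUp.comp hb]

theorem BinaryJoin.continuous_left {f : Y → BinaryJoin A B} (hf : Continuous f)
    (h : ∀ y, 0 < (f y).weight false) : Continuous fun y => (f y).left (h y) :=
  continuous_uliftDown.comp (Join.continuous_point_comp hf false h)

theorem BinaryJoin.continuous_right {f : Y → BinaryJoin A B} (hf : Continuous f)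
    (h : ∀ y, 0 < (f y).weight true) : Continuous fun y => (f y).right (h y) :=
  continuous_uliftDown.comp (Join.continuous_point_comp hf true h)

/-- Homeomorphisms of two spaces induce a homeomorphism of their joins. -/
def BinaryJoin.congrRight (A : Type u) [TopologicalSpace A] {B : Type v} {C : Type v}
    [TopologicalSpace B] [TopologicalSpace C] (e : B ≃ₜ C) : BinaryJoin A B ≃ₜ BinaryJoin A C :=
  Join.homeomorph fun c => match c with
    | false => Homeomorph.refl (ULift A)
    | true => (Homeomorph.ulift.trans e).trans Homeomorph.ulift.symm

end PairJoin

/-! ### Splitting an iterated join into two parts -/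

section Mix

variable {X : Type u} {ι₁ ι₂ : Type*} [Fintype ι₁] [Fintype ι₂] {s r : ℝ}

/-- The point `s a + r b` of an iterated join. -/
def mix (hs : 0 ≤ s) (hr : 0 ≤ r) (h : s + r = 1) (a : 0 < s → Join (fun _ : ι₁ => X))
    (b : 0 < r → Join (fun _ : ι₂ => X)) : Join (fun _ : ι₁ ⊕ ι₂ => X) where
  weight := Sum.elim (fun i => scaled s fun h => (a h).weight i)
    fun i => scaled r fun h => (b h).weight i
  weight_mem := by
    refine ⟨?_, ?_⟩
    · rintro (i | i)
      exacts [scaled_nonneg fun h => (a h).weight_nonneg i,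
        scaled_nonneg fun h => (b h).weight_nonneg i]
    · have h1 : ∑ i, scaled s (fun h => (a h).weight i) = s := by
        by_cases h' : 0 < s
        · simp only [scaled_of_pos h', ← Finset.mul_sum, (a h').sum_weight, mul_one]
        · simp only [scaled_of_not h', Finset.sum_const_zero]
          linarith
      have h2 : ∑ i, scaled r (fun h => (b h).weight i) = r := by
        by_cases h' : 0 < r
        · simp only [scaled_of_pos h', ← Finset.mul_sum, (b h').sum_weight, mul_one]
        · simp only [scaled_of_not h', Finset.sum_const_zero]
          linarith
      rw [Fintype.sum_sum_type]
      simp only [Sum.elim_inl, Sum.elim_inr, h1, h2, h]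
  point
    | Sum.inl i => fun h =>
      (a (pos_of_scaled_pos h).choose).point i (pos_of_scaled_pos h).choose_spec
    | Sum.inr i => fun h =>
      (b (pos_of_scaled_pos h).choose).point i (pos_of_scaled_pos h).choose_spec

/-- The total weight of the first summand. -/
def inlWeight (x : Join (fun _ : ι₁ ⊕ ι₂ => X)) : ℝ := ∑ i, x.weight (Sum.inl i)

/-- The total weight of the second summand. -/
def inrWeight (x : Join (fun _ : ι₁ ⊕ ι₂ => X)) : ℝ := ∑ i, x.weight (Sum.inr i)

theorem inlWeight_nonneg (x : Join (fun _ : ι₁ ⊕ ι₂ => X)) : 0 ≤ inlWeight x :=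
  Finset.sum_nonneg fun _ _ => x.weight_nonneg _

theorem inrWeight_nonneg (x : Join (fun _ : ι₁ ⊕ ι₂ => X)) : 0 ≤ inrWeight x :=
  Finset.sum_nonneg fun _ _ => x.weight_nonneg _

theorem inlWeight_add_inrWeight (x : Join (fun _ : ι₁ ⊕ ι₂ => X)) :
    inlWeight x + inrWeight x = 1 := by
  rw [← x.sum_weight, Fintype.sum_sum_type, inlWeight, inrWeight]

/-- The normalized first part of a point of an iterated join. -/
def inlPart (x : Join (fun _ : ι₁ ⊕ ι₂ => X)) (h : 0 < inlWeight x) : Join (fun _ : ι₁ => X) :=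
  Join.normalize (fun i => x.weight (Sum.inl i)) (fun _ => x.weight_nonneg _) h
    fun i h => x.point (Sum.inl i) h

/-- The normalized second part of a point of an iterated join. -/
def inrPart (x : Join (fun _ : ι₁ ⊕ ι₂ => X)) (h : 0 < inrWeight x) : Join (fun _ : ι₂ => X) :=
  Join.normalize (fun i => x.weight (Sum.inr i)) (fun _ => x.weight_nonneg _) h
    fun i h => x.point (Sum.inr i) h

theorem mix_parts (x : Join (fun _ : ι₁ ⊕ ι₂ => X)) :
    mix (inlWeight_nonneg x) (inrWeight_nonneg x) (inlWeight_add_inrWeight x) (inlPart x)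
      (inrPart x) = x := by
  refine Join.ext' ?_ ?_
  · rintro (i | i)
    · show scaled _ _ = _
      by_cases h : 0 < inlWeight x
      · rw [scaled_of_pos h]
        exact mul_div_cancel₀ _ h.ne'
      · rw [scaled_of_not h]
        exact ((Finset.sum_eq_zero_iff_of_nonneg fun _ _ => x.weight_nonneg _).1
          (le_antisymm (not_lt.1 h) (inlWeight_nonneg x)) i (Finset.mem_univ i)).symm
    · show scaled _ _ = _
      by_cases h : 0 < inrWeight x
      · rw [scaled_of_pos h]
        exact mul_div_cancel₀ _ h.ne'
      · rw [scaled_of_not h]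
        exact ((Finset.sum_eq_zero_iff_of_nonneg fun _ _ => x.weight_nonneg _).1
          (le_antisymm (not_lt.1 h) (inrWeight_nonneg x)) i (Finset.mem_univ i)).symm
  · rintro (i | i) _ _ <;> rfl

variable {hs : 0 ≤ s} {hr : 0 ≤ r} {h : s + r = 1} {a : 0 < s → Join (fun _ : ι₁ => X)}
    {b : 0 < r → Join (fun _ : ι₂ => X)}

theorem inlWeight_mix : inlWeight (mix hs hr h a b) = s := by
  show ∑ i, scaled s (fun h => (a h).weight i) = s
  by_cases h' : 0 < s
  · simp only [scaled_of_pos h', ← Finset.mul_sum, (a h').sum_weight, mul_one]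
  · simp only [scaled_of_not h', Finset.sum_const_zero]
    linarith

theorem inrWeight_mix : inrWeight (mix hs hr h a b) = r := by
  show ∑ i, scaled r (fun h => (b h).weight i) = r
  by_cases h' : 0 < r
  · simp only [scaled_of_pos h', ← Finset.mul_sum, (b h').sum_weight, mul_one]
  · simp only [scaled_of_not h', Finset.sum_const_zero]
    linarith

theorem inlPart_mix (h' : 0 < inlWeight (mix hs hr h a b)) (h'' : 0 < s) :
    inlPart (mix hs hr h a b) h' = a h'' := by
  refine Join.ext' (fun i => ?_) fun i _ _ => rfl
  show scaled s (fun h => (a h).weight i) / inlWeight _ = _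
  rw [inlWeight_mix, scaled_of_pos h'', mul_div_cancel_left₀ _ h''.ne']

theorem inrPart_mix (h' : 0 < inrWeight (mix hs hr h a b)) (h'' : 0 < r) :
    inrPart (mix hs hr h a b) h' = b h'' := by
  refine Join.ext' (fun i => ?_) fun i _ _ => rfl
  show scaled r (fun h => (b h).weight i) / inrWeight _ = _
  rw [inrWeight_mix, scaled_of_pos h'', mul_div_cancel_left₀ _ h''.ne']

variable [TopologicalSpace X] {Y : Type*} [TopologicalSpace Y]

theorem continuous_inlWeight :
    Continuous (inlWeight : Join (fun _ : ι₁ ⊕ ι₂ => X) → ℝ) :=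
  continuous_finsetSum _ fun _ _ => Join.continuous_weight _

theorem continuous_inrWeight :
    Continuous (inrWeight : Join (fun _ : ι₁ ⊕ ι₂ => X) → ℝ) :=
  continuous_finsetSum _ fun _ _ => Join.continuous_weight _

theorem continuous_inlPart {f : Y → Join (fun _ : ι₁ ⊕ ι₂ => X)} (hf : Continuous f)
    (h : ∀ y, 0 < inlWeight (f y)) : Continuous fun y => inlPart (f y) (h y) := by
  refine Join.continuous_normalize (fun i => ?_) fun i => ?_
  · exact ((Join.continuous_weight (Z := fun _ : ι₁ ⊕ ι₂ => X) (Sum.inl i)).comp hf :)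
  · exact Join.continuous_point_comp (hf.comp continuous_subtype_val) (Sum.inl i) fun y => y.2

theorem continuous_inrPart {f : Y → Join (fun _ : ι₁ ⊕ ι₂ => X)} (hf : Continuous f)
    (h : ∀ y, 0 < inrWeight (f y)) : Continuous fun y => inrPart (f y) (h y) := by
  refine Join.continuous_normalize (fun i => ?_) fun i => ?_
  · exact ((Join.continuous_weight (Z := fun _ : ι₁ ⊕ ι₂ => X) (Sum.inr i)).comp hf :)
  · exact Join.continuous_point_comp (hf.comp continuous_subtype_val) (Sum.inr i) fun y => y.2

theorem continuous_mix {s r : Y → ℝ} {hs : ∀ y, 0 ≤ s y} {hr : ∀ y, 0 ≤ r y}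
    {h : ∀ y, s y + r y = 1} {a : ∀ y, 0 < s y → Join (fun _ : ι₁ => X)}
    {b : ∀ y, 0 < r y → Join (fun _ : ι₂ => X)}
    (hsc : Continuous s) (hrc : Continuous r) (ha : Continuous fun y : {y // 0 < s y} => a y.1 y.2)
    (hb : Continuous fun y : {y // 0 < r y} => b y.1 y.2) :
    Continuous fun y => mix (hs y) (hr y) (h y) (a y) (b y) := by
  refine Join.continuous_of ?_ ?_
  · rintro (i | i)
    · exact continuous_scaled hsc hs (fun y h => (a y h).weight_nonneg i)
        (fun y h => (a y h).weight_le_one i)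
        ((Join.continuous_weight (Z := fun _ : ι₁ => X) i).comp ha :)
    · exact continuous_scaled hrc hr (fun y h => (b y h).weight_nonneg i)
        (fun y h => (b y h).weight_le_one i)
        ((Join.continuous_weight (Z := fun _ : ι₂ => X) i).comp hb :)
  · rintro (i | i)
    · have : Continuous fun y : {y // 0 < scaled (s y) fun h => (a y h).weight i} =>
          (⟨y.1, (pos_of_scaled_pos y.2).choose⟩ : {y // 0 < s y}) :=
        continuous_subtype_val.subtype_mk _
      exact Join.continuous_point_comp (ha.comp this) i
        fun y => (pos_of_scaled_pos y.2).choose_spec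
    · have : Continuous fun y : {y // 0 < scaled (r y) fun h => (b y h).weight i} =>
          (⟨y.1, (pos_of_scaled_pos y.2).choose⟩ : {y // 0 < r y}) :=
        continuous_subtype_val.subtype_mk _
      exact Join.continuous_point_comp (hb.comp this) i
        fun y => (pos_of_scaled_pos y.2).choose_spec

end Mix

/-! ### The order complex as a cone over a greatest element -/

section Cone

variable {P : Type v}

open Classical in
/-- The point `k b + (1 - k) t` of the order complex, where `b` is defined only if `0 < k`. -/
def coneMix (t : P) (k : ℝ) (b : 0 < k → P → ℝ) (p : P) : ℝ :=
  scaled k (fun h => b h p) + (1 - k) * (Pi.single t 1 : P → ℝ) p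

theorem coneMix_of_eq_one {t : P} {k : ℝ} {b : 0 < k → P → ℝ} (hk : k = 1) (h : 0 < k) :
    coneMix t k b = b h := by
  subst hk
  funext p
  rw [coneMix, scaled_of_pos h]
  ring

theorem coneMix_one {t : P} {b : P → ℝ} : coneMix t 1 (fun _ => b) = b :=
  coneMix_of_eq_one rfl one_pos

variable [Fintype P]

theorem continuous_coneMix {Y : Type*} [TopologicalSpace Y] (t : P) {k : Y → ℝ} (hk : Continuous k)
    (h0 : ∀ y, 0 ≤ k y) {b : ∀ y, 0 < k y → P → ℝ} (hb : ∀ y h, b y h ∈ stdSimplex ℝ P)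
    (hbc : Continuous fun y : {y // 0 < k y} => b y.1 y.2) :
    Continuous fun y => coneMix t (k y) (b y) := by
  refine continuous_pi fun p => ?_
  refine Continuous.add (continuous_scaled hk h0 (fun y h => (hb y h).1 p) (fun y h => ?_)
    ((continuous_apply p).comp hbc)) ((continuous_const.sub hk).mul continuous_const)
  rw [← (hb y h).2]
  exact Finset.single_le_sum (fun q _ => (hb y h).1 q) (Finset.mem_univ p)

variable [PartialOrder P]

/-- The points of the order complex of the subset `A` of `P`. -/
def IsChainPoint (A : Set P) (b : P → ℝ) : Prop :=
  b ∈ stdSimplex ℝ P ∧ (∀ p, 0 < b p → p ∈ A) ∧ IsChain (· ≤ ·) {p | 0 < b p}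

theorem isChainPoint_coneMix {A : Set P} {t : P} (ht : ∀ p, p ≤ t) (htA : t ∈ A) {k : ℝ}
    (h0 : 0 ≤ k) (h1 : k ≤ 1) {b : 0 < k → P → ℝ} (hb : ∀ h, IsChainPoint A (b h)) :
    IsChainPoint A (coneMix t k b) := by
  classical
  have hpos : ∀ p, 0 < coneMix t k b p → p = t ∨ ∃ h, 0 < b h p := by
    intro p hp
    by_contra! h'
    refine hp.ne' ?_
    rw [coneMix, Pi.single_eq_of_ne h'.1, mul_zero, add_zero]
    refine le_antisymm (not_lt.1 fun h => ?_) (scaled_nonneg fun h => (hb h).1.1 p)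
    obtain ⟨h2, h3⟩ := pos_of_scaled_pos h
    exact h3.not_ge (h'.2 h2)
  refine ⟨⟨fun p => add_nonneg (scaled_nonneg fun h => (hb h).1.1 p)
    (mul_nonneg (sub_nonneg.2 h1) ?_), ?_⟩, fun p hp => ?_, fun p hp q hq _ => ?_⟩
  · rw [Pi.single_apply]
    split_ifs <;> norm_num
  · simp only [coneMix, Finset.sum_add_distrib, ← Finset.mul_sum]
    rw [(single_mem_stdSimplex ℝ t).2, mul_one]
    by_cases h : 0 < k
    · simp only [scaled_of_pos h, ← Finset.mul_sum, (hb h).1.2]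
      ring
    · simp only [scaled_of_not h, Finset.sum_const_zero]
      linarith
  · rcases hpos p hp with rfl | ⟨h, hp'⟩
    exacts [htA, (hb h).2.1 p hp']
  · rcases hpos p hp with rfl | ⟨h, hp'⟩
    · exact Or.inr (ht q)
    · rcases hpos q hq with rfl | ⟨_, hq'⟩
      · exact Or.inl (ht p)
      · exact (hb h).2.2.total hp' hq'

end Cone

/-! ### Suspended diagrams and joins -/

section Suspension

variable {P : Type v} [PartialOrder P] [Fintype P]
variable {ι₁ ι₂ : Type w} {X : Type u}

/-- Add a set of indices to all values of `l`. -/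
def suspend (ι₁ : Type w) (l : P → Set ι₂) (p : P) : Set (ι₁ ⊕ ι₂) :=
  {i | Sum.elim (fun _ => True) (fun j => j ∈ l p) i}

variable [Fintype ι₁] [Fintype ι₂] {A : Set P} {l : P → Set ι₂} {t : P}

theorem mem_realization_iff {ι : Type*} [Fintype ι] {l : P → Set ι}
    {y : (P → ℝ) × Join (fun _ : ι => X)} : y ∈ realization X A l ↔
    IsChainPoint A y.1 ∧ ∀ p i, 0 < y.1 p → 0 < y.2.weight i → i ∈ l p :=
  ⟨fun h => ⟨⟨h.1, h.2.1, h.2.2.1⟩, h.2.2.2⟩, fun h => ⟨h.1.1, h.1.2.1, h.1.2.2, h.2⟩⟩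

theorem mix_mem_realization {b : P → ℝ} (hb : IsChainPoint A b) {s r : ℝ} (hs : 0 ≤ s) (hr : 0 ≤ r)
    (h : s + r = 1) {x : 0 < s → Join (fun _ : ι₁ => X)} {y : 0 < r → Join (fun _ : ι₂ => X)}
    (hl : ∀ p i h, 0 < b p → 0 < (y h).weight i → i ∈ l p) :
    (b, mix hs hr h x y) ∈ realization X A (suspend ι₁ l) := by
  refine mem_realization_iff.2 ⟨hb, ?_⟩
  rintro p (i | i) hp hi
  · trivial
  · obtain ⟨h, h'⟩ := pos_of_scaled_pos hi
    exact hl p i h hp h'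

variable [TopologicalSpace X]

/-- A point of the suspended homotopy colimit as a point of a join. -/
def desuspend : C(realization X A (suspend ι₁ l),
    BinaryJoin (Join (fun _ : ι₁ => X)) (realization X A l)) where
  toFun y := pairJoin (inlWeight_nonneg y.1.2) (inrWeight_nonneg y.1.2)
    (inlWeight_add_inrWeight y.1.2) (inlPart y.1.2) fun h => ⟨(y.1.1, inrPart y.1.2 h),
      mem_realization_iff.2 ⟨(mem_realization_iff.1 y.2).1, fun p i hp hi =>
        (mem_realization_iff.1 y.2).2 p (Sum.inr i) hp ((div_pos_iff_of_pos_right h).1 hi)⟩⟩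
  continuous_toFun := by
    have h0 : Continuous fun y : realization X A (suspend ι₁ l) => y.1.2 := by fun_prop
    refine continuous_pairJoin (continuous_inlWeight.comp h0) (continuous_inrWeight.comp h0) ?_ ?_
    · exact continuous_inlPart (h0.comp continuous_subtype_val) fun y => y.2
    · refine Continuous.subtype_mk (Continuous.prodMk (by fun_prop) ?_) _
      exact continuous_inrPart (h0.comp continuous_subtype_val) fun y => y.2

theorem weight_false_pos {E F : Type*} {j : BinaryJoin E F}
    (h : 0 < clip (2 * j.weight false)) : 0 < j.weight false := by
  by_contra! h'
  rw [clip_of_nonpos (by linarith)] at h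
  exact h.false

theorem weight_true_pos {E F : Type*} {j : BinaryJoin E F}
    (h : 0 < clip (2 * j.weight true)) : 0 < j.weight true := by
  by_contra! h'
  rw [clip_of_nonpos (by linarith)] at h
  exact h.false

/-- Separates the two cutoffs in `resuspend`: the second part keeps weight only for `r > 1/2`, where
the cone parameter `clip (2 * r)` is `1`. -/
theorem one_lt_of_clip {s r : ℝ} (hsr : s + r = 1) (h : 0 < 1 - clip (2 * s)) : 1 < 2 * r := by
  by_contra! h'
  rw [clip_of_one_le (by linarith)] at h
  linarith

theorem half_lt_weight_true {E F : Type*} {j : BinaryJoin E F}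
    (h : 0 < 1 - clip (2 * j.weight false)) : 0 < j.weight true := by
  linarith [one_lt_of_clip j.weight_add_weight h]

/-- A point of a join as a point of the suspended homotopy colimit. -/
def resuspend (ht : ∀ p, p ≤ t) (htA : t ∈ A) :
    C(BinaryJoin (Join (fun _ : ι₁ => X)) (realization X A l),
      realization X A (suspend ι₁ l)) where
  -- The pair `(b, x)` is undefined at weight `r = 0`, so `b` is moved to the apex `t` as `r` tends
  -- to `0`. Weight at `t` would force the support of `x` into `l t`; hence `x` gets weight `0` as
  -- soon as `r ≤ 1/2`, and the coning happens only for `r < 1/2`.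
  toFun j := ⟨(coneMix t (clip (2 * j.weight true)) fun h => (j.right (weight_true_pos h)).1.1,
    mix (clip_nonneg (2 * j.weight false)) (sub_nonneg.2 (clip_le_one _)) (by ring)
      (fun h => j.left (weight_false_pos h)) fun h => (j.right (half_lt_weight_true h)).1.2),
    mix_mem_realization (isChainPoint_coneMix ht htA (clip_nonneg _) (clip_le_one _)
      fun h => (mem_realization_iff.1 (j.right (weight_true_pos h)).2).1) _ _ _
      fun p i h hp hi => by
        have hc : clip (2 * j.weight true) = 1 :=
          clip_of_one_le (one_lt_of_clip j.weight_add_weight h).le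
        refine (mem_realization_iff.1 (j.right (half_lt_weight_true h)).2).2 p i ?_ hi
        rwa [coneMix_of_eq_one hc (by rw [hc]; exact one_pos)] at hp⟩
  continuous_toFun := by
    have h1 := Join.continuous_weight
      (Z := pairFamily (Join (fun _ : ι₁ => X)) (realization X A l)) false
    have h2 := Join.continuous_weight
      (Z := pairFamily (Join (fun _ : ι₁ => X)) (realization X A l)) true
    have hc := continuous_clip
    refine Continuous.subtype_mk (Continuous.prodMk (continuous_coneMix t (by fun_prop)
      (fun j => clip_nonneg _) (fun j h => (j.right (weight_true_pos h)).2.1) ?_)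
      (continuous_mix (by fun_prop) (by fun_prop) ?_ ?_)) _
    · exact continuous_fst.comp (continuous_subtype_val.comp
        (BinaryJoin.continuous_right continuous_subtype_val fun j => weight_true_pos j.2))
    · exact BinaryJoin.continuous_left continuous_subtype_val fun j => weight_false_pos j.2
    · exact continuous_snd.comp (continuous_subtype_val.comp
        (BinaryJoin.continuous_right continuous_subtype_val fun j => half_lt_weight_true j.2))

theorem inlWeight_resuspend (ht : ∀ p, p ≤ t) (htA : t ∈ A)
    (j : BinaryJoin (Join (fun _ : ι₁ => X)) (realization X A l)) :
    inlWeight (resuspend ht htA j).1.2 = clip (2 * j.weight false) :=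
  inlWeight_mix (s := clip (2 * j.weight false)) (r := 1 - clip (2 * j.weight false))
    (hs := clip_nonneg _) (hr := sub_nonneg.2 (clip_le_one _)) (h := by ring)

theorem inrWeight_resuspend (ht : ∀ p, p ≤ t) (htA : t ∈ A)
    (j : BinaryJoin (Join (fun _ : ι₁ => X)) (realization X A l)) :
    inrWeight (resuspend ht htA j).1.2 = 1 - clip (2 * j.weight false) :=
  inrWeight_mix (s := clip (2 * j.weight false)) (r := 1 - clip (2 * j.weight false))
    (hs := clip_nonneg _) (hr := sub_nonneg.2 (clip_le_one _)) (h := by ring)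

theorem interp_pos {a b c : ℝ} (h : 0 < a → 0 < b) (hb : 0 ≤ b)
    (h' : 0 < (1 - clip c) * a + clip c * b) : 0 < b := by
  refine hb.lt_of_ne' fun e => ?_
  have ha : a ≤ 0 := not_lt.1 fun ha => (h ha).ne' e
  have := mul_nonpos_of_nonneg_of_nonpos (sub_nonneg.2 (clip_le_one c)) ha
  rw [e, mul_zero, add_zero] at h'
  exact h'.not_ge this

theorem interp_nonneg {a b c : ℝ} (ha : 0 ≤ a) (hb : 0 ≤ b) :
    0 ≤ (1 - clip c) * a + clip c * b :=
  add_nonneg (mul_nonneg (sub_nonneg.2 (clip_le_one c)) ha) (mul_nonneg (clip_nonneg c) hb)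

/-- Where the second summand survives, `b` has not been coned, so the composite changes only the two
weights, and these are interpolated linearly. -/
theorem desuspend_comp_resuspend (ht : ∀ p, p ≤ t) (htA : t ∈ A) :
    (desuspend.comp (resuspend (X := X) (ι₁ := ι₁) (l := l) ht htA)).Homotopic
      (ContinuousMap.id _) := by
  have hl : ∀ q : ℝ × BinaryJoin (Join (fun _ : ι₁ => X)) (realization X A l),
      0 < (1 - clip q.1) * clip (2 * q.2.weight false) + clip q.1 * q.2.weight false →
      0 < q.2.weight false := fun q h =>
    interp_pos weight_false_pos (q.2.weight_nonneg false) h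
  have hr : ∀ q : ℝ × BinaryJoin (Join (fun _ : ι₁ => X)) (realization X A l),
      0 < (1 - clip q.1) * (1 - clip (2 * q.2.weight false)) + clip q.1 * q.2.weight true →
      0 < q.2.weight true := fun q h =>
    interp_pos half_lt_weight_true (q.2.weight_nonneg true) h
  refine homotopic_of_continuous (fun q => pairJoin
    (interp_nonneg (clip_nonneg _) (q.2.weight_nonneg false))
    (interp_nonneg (sub_nonneg.2 (clip_le_one _)) (q.2.weight_nonneg true))
    (by linear_combination (clip q.1) * q.2.weight_add_weight)
    (fun h => q.2.left (hl q h)) fun h => q.2.right (hr q h)) ?_ ?_ ?_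
  · have h1 := Join.continuous_weight
      (Z := pairFamily (Join (fun _ : ι₁ => X)) (realization X A l)) false
    have h2 := Join.continuous_weight
      (Z := pairFamily (Join (fun _ : ι₁ => X)) (realization X A l)) true
    have hc := continuous_clip
    refine continuous_pairJoin (by fun_prop) (by fun_prop) ?_ ?_
    · exact BinaryJoin.continuous_left (continuous_snd.comp continuous_subtype_val)
        fun q => hl q.1 q.2
    · exact BinaryJoin.continuous_right (continuous_snd.comp continuous_subtype_val)
        fun q => hr q.1 q.2
  · intro j
    have h0 : clip 0 = 0 := clip_of_nonpos le_rfl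
    refine BinaryJoin.ext ?_ (fun h h' => ?_) fun h h' => ?_
    · refine Eq.trans ?_ (inlWeight_resuspend ht htA j).symm
      show (1 - clip 0) * _ + clip 0 * _ = _
      rw [h0]
      ring
    · have h1 : 0 < clip (2 * j.weight false) := by
        rw [← inlWeight_resuspend ht htA j]
        exact h'
      exact (inlPart_mix (hs := clip_nonneg _) (hr := sub_nonneg.2 (clip_le_one _))
        (h := by ring) h' h1).symm
    · have h1 : 0 < 1 - clip (2 * j.weight false) := by
        rw [← inrWeight_resuspend ht htA j]
        exact h'
      have hc : clip (2 * j.weight true) = 1 :=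
        clip_of_one_le (one_lt_of_clip j.weight_add_weight h1).le
      refine Subtype.ext (Prod.ext ?_ (inrPart_mix
        (hs := clip_nonneg _) (hr := sub_nonneg.2 (clip_le_one _)) (h := by ring) h' h1).symm)
      exact (coneMix_of_eq_one (t := t) (k := clip (2 * j.weight true))
        (b := fun h => (j.right (weight_true_pos h)).1.1) hc (by rw [hc]; exact one_pos)).symm
  · intro j
    have h0 : clip 1 = 1 := clip_of_one_le le_rfl
    refine BinaryJoin.ext ?_ (fun h h' => rfl) fun h h' => rfl
    show (1 - clip 1) * _ + clip 1 * j.weight false = j.weight false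
    rw [h0]
    ring

/-- The coning is undone in the first half and the weights are restored in the second: `x` may
regain weight only after the mass added at `t` is gone. -/
theorem resuspend_comp_desuspend (ht : ∀ p, p ≤ t) (htA : t ∈ A) :
    ((resuspend (X := X) (ι₁ := ι₁) (l := l) ht htA).comp desuspend).Homotopic
      (ContinuousMap.id _) := by
  have hl : ∀ q : ℝ × realization X A (suspend ι₁ l),
      0 < (1 - clip (2 * q.1 - 1)) * clip (2 * inlWeight q.2.1.2) +
        clip (2 * q.1 - 1) * inlWeight q.2.1.2 → 0 < inlWeight q.2.1.2 := fun q h => by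
    refine interp_pos (fun h => ?_) (inlWeight_nonneg _) h
    by_contra! h'
    rw [clip_of_nonpos (by linarith)] at h
    exact h.false
  have hr : ∀ q : ℝ × realization X A (suspend ι₁ l),
      0 < (1 - clip (2 * q.1 - 1)) * (1 - clip (2 * inlWeight q.2.1.2)) +
        clip (2 * q.1 - 1) * inrWeight q.2.1.2 → 0 < inrWeight q.2.1.2 := fun q h => by
    refine interp_pos (fun h => ?_) (inrWeight_nonneg _) h
    linarith [one_lt_of_clip (inlWeight_add_inrWeight q.2.1.2) h]
  refine homotopic_of_continuous (fun q => ⟨(coneMix t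
      ((1 - clip (2 * q.1)) * clip (2 * inrWeight q.2.1.2) + clip (2 * q.1) * 1)
      (fun _ => q.2.1.1),
    mix (interp_nonneg (clip_nonneg _) (inlWeight_nonneg q.2.1.2))
      (interp_nonneg (sub_nonneg.2 (clip_le_one _)) (inrWeight_nonneg q.2.1.2))
      (by linear_combination (clip (2 * q.1 - 1)) * inlWeight_add_inrWeight q.2.1.2)
      (fun h => inlPart q.2.1.2 (hl q h)) fun h => inrPart q.2.1.2 (hr q h)),
    mix_mem_realization (isChainPoint_coneMix ht htA
      (interp_nonneg (clip_nonneg _) zero_le_one) ?_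
      fun h => (mem_realization_iff.1 q.2.2).1) _ _ _ fun p i h hp hi => ?_⟩) ?_ ?_ ?_
  · have h1 := clip_le_one (2 * inrWeight q.2.1.2)
    have h2 := clip_le_one (2 * q.1)
    nlinarith
  · refine (mem_realization_iff.1 q.2.2).2 p (Sum.inr i) ?_
      ((div_pos_iff_of_pos_right (hr q h)).1 hi)
    have hc : (1 - clip (2 * q.1)) * clip (2 * inrWeight q.2.1.2) + clip (2 * q.1) * 1 = 1 := by
      by_cases hq : 1 ≤ 2 * q.1
      · rw [clip_of_one_le hq]
        ring
      · rw [show clip (2 * q.1 - 1) = 0 from clip_of_nonpos (by linarith), sub_zero, one_mul,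
          zero_mul, add_zero] at h
        rw [show clip (2 * inrWeight q.2.1.2) = 1 from
          clip_of_one_le (one_lt_of_clip (inlWeight_add_inrWeight q.2.1.2) h).le]
        ring
    rw [hc, coneMix_one] at hp
    exact hp
  · have h0 : Continuous fun q : ℝ × realization X A (suspend ι₁ l) => q.2.1.2 := by fun_prop
    have h1 := continuous_inlWeight.comp h0
    have h2 := continuous_inrWeight.comp h0
    have hc := continuous_clip
    simp only [Function.comp_def] at h1 h2
    refine Continuous.subtype_mk (Continuous.prodMk (continuous_coneMix t (by fun_prop)
      (fun q => interp_nonneg (clip_nonneg _) zero_le_one) (fun q _ => q.2.2.1) (by fun_prop))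
      (continuous_mix (by fun_prop) (by fun_prop) ?_ ?_)) _
    · exact continuous_inlPart (h0.comp continuous_subtype_val) fun q => hl q.1 q.2
    · exact continuous_inrPart (h0.comp continuous_subtype_val) fun q => hr q.1 q.2
  · intro y
    have h0 : clip (2 * 0) = 0 := clip_of_nonpos (by norm_num)
    have h1 : clip (2 * 0 - 1) = 0 := clip_of_nonpos (by norm_num)
    refine Subtype.ext (Prod.ext ?_ ?_)
    · show coneMix t ((1 - clip (2 * 0)) * clip (2 * inrWeight y.1.2) + clip (2 * 0) * 1) _ =
        coneMix t (clip (2 * inrWeight y.1.2)) fun _ => y.1.1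
      rw [show (1 - clip (2 * 0)) * clip (2 * inrWeight y.1.2) + clip (2 * 0) * 1 =
        clip (2 * inrWeight y.1.2) by rw [h0]; ring]
    · refine Join.ext' ?_ ?_
      · rintro (i | i)
        · show scaled ((1 - clip (2 * 0 - 1)) * clip (2 * inlWeight y.1.2) +
            clip (2 * 0 - 1) * inlWeight y.1.2) _ = scaled (clip (2 * inlWeight y.1.2)) _
          congr 1
          · rw [h1]; ring
          · refine Function.hfunext (by rw [h1, sub_zero, one_mul, zero_mul, add_zero]; rfl)
              fun _ _ _ => HEq.rfl
        · show scaled ((1 - clip (2 * 0 - 1)) * (1 - clip (2 * inlWeight y.1.2)) +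
            clip (2 * 0 - 1) * inrWeight y.1.2) _ = scaled (1 - clip (2 * inlWeight y.1.2)) _
          congr 1
          · rw [h1]; ring
          · refine Function.hfunext (by rw [h1, sub_zero, one_mul, zero_mul, add_zero]; rfl)
              fun _ _ _ => HEq.rfl
      · rintro (i | i) _ _ <;> rfl
  · intro y
    have h0 : clip (2 * 1) = 1 := clip_of_one_le (by norm_num)
    have h1 : clip (2 * 1 - 1) = 1 := clip_of_one_le (by norm_num)
    refine Subtype.ext (Prod.ext ?_ ?_)
    · show coneMix t ((1 - clip (2 * 1)) * clip (2 * inrWeight y.1.2) + clip (2 * 1) * 1) _ = y.1.1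
      rw [show (1 - clip (2 * 1)) * clip (2 * inrWeight y.1.2) + clip (2 * 1) * 1 = 1 by
        rw [h0]; ring, coneMix_one]
    · refine Eq.trans ?_ (mix_parts y.1.2)
      refine Join.ext' ?_ ?_
      · rintro (i | i)
        · show scaled ((1 - clip (2 * 1 - 1)) * clip (2 * inlWeight y.1.2) +
            clip (2 * 1 - 1) * inlWeight y.1.2) _ = scaled (inlWeight y.1.2) _
          congr 1
          · rw [h1]; ring
          · refine Function.hfunext (by rw [h1, sub_self, one_mul, zero_mul, zero_add])
              fun _ _ _ => HEq.rfl
        · show scaled ((1 - clip (2 * 1 - 1)) * (1 - clip (2 * inlWeight y.1.2)) +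
            clip (2 * 1 - 1) * inrWeight y.1.2) _ = scaled (inrWeight y.1.2) _
          congr 1
          · rw [h1]; ring
          · refine Function.hfunext (by rw [h1, sub_self, one_mul, zero_mul, zero_add])
              fun _ _ _ => HEq.rfl
      · rintro (i | i) _ _ <;> rfl

variable (ι₁ X l)

/-- The homotopy colimit of a suspended diagram is the suspension of the homotopy colimit. -/
theorem nonempty_homotopyEquiv_suspend (ht : ∀ p, p ≤ t) (htA : t ∈ A) :
    Nonempty (ContinuousMap.HomotopyEquiv (realization X A (suspend ι₁ l))
      (BinaryJoin (Join (fun _ : ι₁ => X)) (realization X A l))) :=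
  ⟨⟨desuspend, resuspend ht htA, resuspend_comp_desuspend ht htA,
    desuspend_comp_resuspend ht htA⟩⟩

end Suspension

/-! ### The homotopy colimit of the diagram of an immersion as a space of pairs -/

section ClosedEmbeddings

variable {X : Type u} [TopologicalSpace X] {ι : Type v} [Fintype ι]

/-- The image is cut out by the vanishing of the weights outside `B`, a closed condition. -/
theorem isClosedEmbedding_forget (B : ι → Prop) :
    Topology.IsClosedEmbedding
      (Join.map (fun i (y : {_x : X // B i}) => y.1) : Join (fun i => {_x : X // B i}) → _) := by
  have hc : Continuous
      (Join.map (fun i (y : {_x : X // B i}) => y.1) : Join (fun i => {_x : X // B i}) → _) :=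
    Join.continuous_map fun _ => continuous_subtype_val
  refine ⟨⟨⟨le_antisymm hc.le_induced (le_generateFrom ?_)⟩, fun z w h => ?_⟩, ?_⟩
  · rintro s (⟨i, U, hU, rfl⟩ | ⟨i, V, hV, rfl⟩)
    · exact isOpen_induced_iff.2 ⟨_, hU.preimage (Join.continuous_weight i), rfl⟩
    · obtain ⟨V', hV', rfl⟩ := isOpen_induced_iff.1 hV
      exact isOpen_induced_iff.2 ⟨{z | ∃ h : 0 < z.weight i, z.point i h ∈ V'},
        TopologicalSpace.isOpen_generateFrom_of_mem (Or.inr ⟨i, V', hV', rfl⟩), rfl⟩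
  · obtain ⟨a, ha, x⟩ := z
    obtain ⟨b, hb, y⟩ := w
    obtain rfl : a = b := congrArg Join.weight h
    refine Join.ext' (fun _ => rfl) fun i hi _ => Subtype.ext ?_
    simp only [Join.map, Join.mk.injEq, heq_eq_eq, true_and] at h
    exact congrFun (congrFun h i) hi
  · have : Set.range (Join.map (fun i (y : {_x : X // B i}) => y.1)) =
        ⋂ i ∈ {i | ¬ B i}, {z : Join (fun _ : ι => X) | z.weight i = 0} := by
      ext z
      simp only [Set.mem_range, Set.mem_iInter]
      constructor
      · rintro ⟨w, rfl⟩ i hi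
        exact le_antisymm (not_lt.1 fun h => hi (w.point i h).2) (w.weight_nonneg i)
      · intro h
        exact ⟨⟨z.weight, z.weight_mem, fun i hi => ⟨z.point i hi, by
          by_contra hB
          exact hi.ne' (h i hB)⟩⟩, rfl⟩
    rw [this]
    exact isClosed_biInter fun i _ => isClosed_eq (Join.continuous_weight i) continuous_const

theorem isClosed_orderComplexBelow (P : Type v) [PartialOrder P] [Fintype P] (p : P) :
    IsClosed {b : P → ℝ | b ∈ stdSimplex ℝ P ∧ IsChain (· ≤ ·) {q | b q ≠ 0} ∧
      ∀ q, b q ≠ 0 → q ≤ p} := by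
  have h0 : ∀ q, IsClosed {b : P → ℝ | b q = 0} := fun q =>
    isClosed_eq (continuous_apply q) continuous_const
  have h1 : {b : P → ℝ | IsChain (· ≤ ·) {q | b q ≠ 0}} =
      ⋂ q, ⋂ q', ⋂ _ : q ≠ q' ∧ ¬ (q ≤ q' ∨ q' ≤ q), {b : P → ℝ | b q = 0} ∪ {b | b q' = 0} := by
    ext b
    simp only [Set.mem_iInter]
    constructor
    · intro h q q' hq
      by_contra h'
      rw [Set.mem_union, not_or] at h'
      exact hq.2 (h h'.1 h'.2 hq.1)
    · intro h q hq q' hq' hne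
      by_contra h'
      rcases h q q' ⟨hne, h'⟩ with h'' | h''
      exacts [hq h'', hq' h'']
  have h2 : {b : P → ℝ | ∀ q, b q ≠ 0 → q ≤ p} = ⋂ q, ⋂ _ : ¬ q ≤ p, {b : P → ℝ | b q = 0} := by
    ext b
    simp only [Set.mem_iInter]
    exact forall_congr' fun q => not_imp_comm
  refine (isClosed_stdSimplex ℝ P).inter (IsClosed.inter ?_ ?_)
  · show IsClosed {b : P → ℝ | IsChain (· ≤ ·) {q | b q ≠ 0}}
    rw [h1]
    exact isClosed_iInter fun q => isClosed_iInter fun q' => isClosed_iInter fun _ =>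
      (h0 q).union (h0 q')
  · show IsClosed {b : P → ℝ | ∀ q, b q ≠ 0 → q ≤ p}
    rw [h2]
    exact isClosed_iInter fun q => isClosed_iInter fun _ => h0 q

theorem exists_greatest_of_isChain {P : Type v} [PartialOrder P] [Finite P] {s : Set P}
    (hs : IsChain (· ≤ ·) s) (hne : s.Nonempty) : ∃ m ∈ s, ∀ q ∈ s, q ≤ m := by
  obtain ⟨m, hm⟩ := s.toFinite.exists_maximal hne
  exact ⟨m, hm.1, fun q hq => (hs.total hq hm.1).elim id fun h => hm.2 hq h⟩

theorem exists_least_of_isChain {P : Type v} [PartialOrder P] [Finite P] {s : Set P}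
    (hs : IsChain (· ≤ ·) s) (hne : s.Nonempty) : ∃ m ∈ s, ∀ q ∈ s, m ≤ q := by
  obtain ⟨m, hm⟩ := s.toFinite.exists_minimal hne
  exact ⟨m, hm.1, fun q hq => (hs.total hq hm.1).elim (fun h => hm.2 hq h) id⟩

theorem support_nonempty {P : Type v} [Fintype P] {b : P → ℝ} (hb : b ∈ stdSimplex ℝ P) :
    {q | b q ≠ 0}.Nonempty := by
  by_contra h
  rw [Set.not_nonempty_iff_eq_empty, Set.eq_empty_iff_forall_notMem] at h
  have := hb.2
  rw [Finset.sum_eq_zero fun q _ => not_not.1 (h q)] at this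
  exact zero_ne_one this

end ClosedEmbeddings

/-! ### Representations of matroids -/

section Immersion

variable {α : Type v} {M : Matroid α} [M.Finite] {X : Type u} [TopologicalSpace X] {ρ : ℕ}
  (l : Immersion M ρ)

/-- The coordinates of a point of the homotopy colimit. -/
def hocolimCoord (y : Hocolim (flatDiagram X l)) : (Flats M → ℝ) × Join (fun _ : Fin ρ => X) :=
  Quot.lift (fun y : PreHocolim (flatDiagram X l) =>
    (y.2.1.1, Join.map (fun i (x : {_x : X // i ∈ l.toFun y.1}) => x.1) y.2.2))
    (by rintro _ _ ⟨h, a, x⟩; rfl) y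

theorem isClosedEmbedding_piece (p : Flats M) : Topology.IsClosedEmbedding
    (fun y : OrderComplexBelow (Flats M) p × (flatDiagram X l).obj (Opposite.op p) =>
      hocolimCoord l (Quot.mk _ ⟨p, y⟩)) :=
  ((isClosed_orderComplexBelow (Flats M) p).isClosedEmbedding_subtypeVal).prodMap
    (isClosedEmbedding_forget fun i => i ∈ l.toFun p)

theorem continuous_hocolimCoord : Continuous (hocolimCoord (X := X) l) :=
  continuous_quot_lift _ (continuous_sigma fun p => (isClosedEmbedding_piece l p).continuous)

/-- The homotopy colimit is covered by finitely many pieces, each mapped by a closed embedding.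
Hence the quotient topology is the subspace topology of the pairs, without any compactness of `X`.
-/
theorem isClosedMap_hocolimCoord : IsClosedMap (hocolimCoord (X := X) l) := by
  intro C hC
  have : hocolimCoord l '' C = ⋃ p : Flats M, (fun y : OrderComplexBelow (Flats M) p ×
      (flatDiagram X l).obj (Opposite.op p) => hocolimCoord l (Quot.mk _ ⟨p, y⟩)) ''
        {y | (Quot.mk _ ⟨p, y⟩ : Hocolim (flatDiagram X l)) ∈ C} := by
    ext z
    simp only [Set.mem_image, Set.mem_iUnion]
    constructor
    · rintro ⟨⟨p, y⟩, hy, rfl⟩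
      exact ⟨p, y, hy, rfl⟩
    · rintro ⟨p, y, hy, rfl⟩
      exact ⟨_, hy, rfl⟩
  rw [this]
  refine isClosed_iUnion_of_finite fun p => (isClosedEmbedding_piece l p).isClosedMap _ ?_
  exact hC.preimage (continuous_quot_mk.comp continuous_sigmaMk)

/-- Taking `m` to be the greatest element of the support of `b` gives a normal form, so injectivity
of the coordinates can be checked on a single piece. -/
theorem mk_eq_mk_of_support {p m : Flats M} (b : OrderComplexBelow (Flats M) p)
    (x : (flatDiagram X l).obj (Opposite.op p)) (hm : b.1 m ≠ 0) (h : ∀ q, b.1 q ≠ 0 → q ≤ m) :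
    (Quot.mk _ ⟨p, b, x⟩ : Hocolim (flatDiagram X l)) =
      Quot.mk _ ⟨m, ⟨b.1, b.2.1, b.2.2.1, h⟩,
        (flatDiagram X l).map (homOfLE (b.2.2.2 m hm)).op x⟩ :=
  Quot.sound (HocolimRel.glue (b.2.2.2 m hm) ⟨b.1, b.2.1, b.2.2.1, h⟩ x)

theorem injective_hocolimCoord : Function.Injective (hocolimCoord (X := X) l) := by
  rintro ⟨p, b, x⟩ ⟨p', b', x'⟩ h
  obtain ⟨m, hm, hmax⟩ := exists_greatest_of_isChain b.2.2.1 (support_nonempty b.2.1)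
  have hb : b.1 = b'.1 := congrArg Prod.fst h
  have h1 := mk_eq_mk_of_support l b x hm hmax
  have h2 := mk_eq_mk_of_support l b' x' (m := m) (hb ▸ hm) (hb ▸ hmax)
  rw [h1, h2] at h ⊢
  rw [(isClosedEmbedding_piece l m).injective h]

/-- The topological representation of a matroid as a space of pairs. -/
theorem image_rep : hocolimCoord l '' rep X l =
    realization X {p | p ≠ ⊥} fun p => (l.toFun p : Set (Fin ρ)) := by
  ext y
  constructor
  · rintro ⟨_, hz, rfl⟩
    simp only [rep, Set.mem_iUnion] at hz
    obtain ⟨a, ha, p, b, x, hb, rfl⟩ := hz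
    refine ⟨b.2.1, fun q hq => ?_, b.2.2.1.mono fun q hq => ne_of_gt hq, fun q i hq hi => ?_⟩
    · rintro rfl
      exact ha.1 (le_bot_iff.1 (hb ⊥ (ne_of_gt hq)))
    · exact l.antitone (b.2.2.2 q (ne_of_gt hq)) (x.point i hi).2
  · obtain ⟨b, x⟩ := y
    rintro ⟨hb, hA, hch, hl⟩
    have hpos : ∀ q, b q ≠ 0 → 0 < b q := fun q hq => (hb.1 q).lt_of_ne' hq
    have hch' : IsChain (· ≤ ·) {q | b q ≠ 0} := hch.mono hpos
    obtain ⟨m, hm, hmax⟩ := exists_greatest_of_isChain hch' (support_nonempty hb)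
    obtain ⟨n, hn, hmin⟩ := exists_least_of_isChain hch' (support_nonempty hb)
    -- The least element of the chain is not `⊥`, so it lies above an atom, and the whole chain does
    -- too.
    obtain ⟨a, ha, han⟩ := (eq_bot_or_exists_atom_le n).resolve_left (hA n (hpos n hn))
    refine ⟨Quot.mk _ ⟨m, ⟨b, hb, hch', hmax⟩,
      SubJoin.restrict (B := (l.toFun m : Set (Fin ρ))) x fun i => hl m i (hpos m hm)⟩, ?_, rfl⟩
    exact Set.mem_iUnion₂.2
      ⟨a, ha, m, ⟨b, hb, hch', hmax⟩, _, fun q hq => han.trans (hmin q hq), rfl⟩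

/-- The topological representation of a matroid is homeomorphic to a space of pairs. -/
def repHomeomorph :
    rep X l ≃ₜ realization X {p | p ≠ ⊥} fun p => (l.toFun p : Set (Fin ρ)) :=
  ((Topology.IsClosedEmbedding.of_continuous_injective_isClosedMap (continuous_hocolimCoord l)
    (injective_hocolimCoord l) (isClosedMap_hocolimCoord l)).isEmbedding.homeomorphImage
      (rep X l)).trans (Homeomorph.setCongr (image_rep l))

/-- Nested sets of equal finite rank have the same closure, so nested flats of equal rank coincide.
-/
theorem rk_lt_rk {p q : Flats M} (h : p < q) : rk M p.1 < rk M q.1 := by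
  refine (rk_mono M h.le).lt_of_ne fun e => h.ne (Subtype.ext ?_)
  have hp := M.eRk_ne_top_iff.2 (M.isRkFinite_set p.1)
  have hq := M.eRk_ne_top_iff.2 (M.isRkFinite_set q.1)
  have he : M.eRk p.1 = M.eRk q.1 := by
    rw [← ENat.natCast_toNat hp, ← ENat.natCast_toNat hq]
    exact congrArg _ e
  rw [← p.2.closure, ← q.2.closure]
  exact (M.isRkFinite_set p.1).closure_eq_closure_of_subset_of_eRk_ge_eRk h.le he.ge

theorem Immersion.strictAnti : StrictAnti fun p => (l.toFun p : Set (Fin ρ)) := by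
  intro p q h
  refine Finset.coe_ssubset.2 ((l.antitone h.le).ssubset_of_ne fun e => ?_)
  have h1 := l.card_add_rk p
  have h2 := l.card_add_rk q
  have := rk_lt_rk h
  rw [e] at h2
  omega

theorem suspend_strictAnti {P : Type*} [PartialOrder P] {ι₁ ι₂ : Type w} {l : P → Set ι₂}
    (hl : StrictAnti l) : StrictAnti (suspend ι₁ l) := by
  intro p q h
  refine ⟨?_, fun h' => (hl h).2 fun j hj => h' (a := Sum.inr j) hj⟩
  rintro (i | i) hi
  exacts [trivial, hl.antitone h.le hi]

theorem nonempty_equiv_suspend {P : Type*} [PartialOrder P] {ι : Type*} {k n : ℕ} {p : P}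
    {s : Finset ι} {l : P → Finset (Fin n)} (h : s.card = k + (l p).card) :
    Nonempty ((s : Set ι) ≃ suspend (Fin k) (fun p => (l p : Set (Fin n))) p) := by
  have e : Fin k ⊕ (l p) ≃ suspend (Fin k) (fun p => (l p : Set (Fin n))) p :=
    { toFun := Sum.elim (fun i => ⟨Sum.inl i, trivial⟩) fun j => ⟨Sum.inr j.1, j.2⟩
      invFun := fun y => match y with
        | ⟨Sum.inl i, _⟩ => Sum.inl i
        | ⟨Sum.inr j, hj⟩ => Sum.inr ⟨j, hj⟩
      left_inv := by rintro (i | i) <;> rfl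
      right_inv := by rintro ⟨i | i, _⟩ <;> rfl }
  exact ⟨(Fintype.equivOfCardEq (by simp [h])).trans e⟩

theorem nonempty_homotopyEquiv_rep (X : Type u) [TopologicalSpace X]
    (hρ : 1 ≤ rank M ∨ ρ = rank M) :
    Nonempty (ContinuousMap.HomotopyEquiv (rep X l)
      (BinaryJoin (JoinPower X (ρ - rank M)) (standardRep M X))) := by
  let t : Flats M := ⟨M.E, M.ground_isFlat⟩
  have ht : ∀ p, p ≤ t := fun p => p.2.subset_ground
  have hle : rank M ≤ ρ := by
    have := l.card_add_rk t
    have : rk M t.1 = rank M := rfl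
    omega
  let c := canonicalImmersion M (rank M) le_rfl
  -- Both sets have `ρ - r(p)` elements.
  have ec : ∀ p, Nonempty ((l.toFun p : Set (Fin ρ)) ≃
      suspend (Fin (ρ - rank M)) (fun p => (c.toFun p : Set (Fin (rank M)))) p) := fun p =>
    nonempty_equiv_suspend (by
      have h1 := l.card_add_rk p
      have h2 := c.card_add_rk p
      omega)
  obtain ⟨f⟩ := nonempty_homotopyEquiv_realization (X := X) {p : Flats M | p ≠ ⊥} l.strictAnti
    (suspend_strictAnti c.strictAnti) fun p => (ec p).some
  -- If the ground flat is `⊥`, the rank is zero, no other flat exists and the cone argument has no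
  -- apex. Then `hρ` gives `ρ = 0`, and both sides are empty.
  by_cases h0 : t = ⊥
  · have hbot : ∀ p : Flats M, p = ⊥ := fun p => le_bot_iff.1 (h0 ▸ ht p)
    have hr : rank M = 0 := by
      have h1 : rank M = rk M (⊥ : Flats M).1 := congrArg (fun p : Flats M => rk M p.1) h0
      have h2 : M.eRk (M.closure ∅) = 0 := by rw [M.eRk_closure_eq, M.eRk_empty]
      rw [h1, rk]
      exact (congrArg ENat.toNat h2).trans rfl
    have h1 : ∀ {n : ℕ} (l' : Immersion M n), IsEmpty (rep X l') := fun l' =>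
      (repHomeomorph l').toEquiv.isEmpty_congr.2 ⟨fun y => by
        obtain ⟨p, hp⟩ := support_nonempty y.2.1
        exact y.2.2.1 p ((y.2.1.1 p).lt_of_ne' hp) (hbot p)⟩
    have h2 : IsEmpty (JoinPower X (ρ - rank M)) :=
      ⟨fun y => absurd y.exists_weight_pos.choose.2 (by omega)⟩
    have h3 : IsEmpty (BinaryJoin (JoinPower X (ρ - rank M)) (standardRep M X)) := by
      refine ⟨fun y => ?_⟩
      obtain ⟨_ | _, hc⟩ := y.exists_weight_pos
      exacts [h2.false (y.left hc), (h1 c).false (y.right hc)]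
    have := h1 l
    exact nonempty_homotopyEquiv_of_isEmpty
  · obtain ⟨g⟩ := nonempty_homotopyEquiv_suspend (Fin (ρ - rank M)) X
      (fun p => (c.toFun p : Set (Fin (rank M)))) ht (A := {p : Flats M | p ≠ ⊥}) h0
    exact ⟨((repHomeomorph l).toHomotopyEquiv.trans f).trans (g.trans
      (BinaryJoin.congrRight (JoinPower X (ρ - rank M)) (repHomeomorph c).symm).toHomotopyEquiv)⟩

end Immersion

end MatroidTop

end

theorem mainTheorem9 {α : Type*} (M : Matroid α) [M.Finite]
    (X : Type*) [TopologicalSpace X] [T2Space X] [Topology.CWComplex (Set.univ : Set X)]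
    (ρ : ℕ) (l : MatroidTop.Immersion M ρ)
    (hρ : 1 ≤ MatroidTop.rank M ∨ ρ = MatroidTop.rank M) :
    Nonempty (ContinuousMap.HomotopyEquiv (MatroidTop.rep X l)
      (MatroidTop.BinaryJoin (MatroidTop.JoinPower X (ρ - MatroidTop.rank M))
        (MatroidTop.standardRep M X))) := by
  exact MatroidTop.nonempty_homotopyEquiv_rep l X hρ
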